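/- **Setting.** Let $A$ be a set of actions with an involution $a\mapsto\breve a$ (converse) and $P$ a set of proposition letters. Formulas of the two-way modal $\mu$-calculus are, up to renaming of bound variables, $$\varphi ::= \bot\mid\top\mid p\mid\bar p\mid x\mid\varphi\vee\varphi\mid\varphi\wedge\varphi\mid\langle a\rangle\varphi\mid[a]\varphi\mid\mu x.\varphi\mid\nu x.\varphi ,$$ and all formulas below have no free fixpoint variables (free variables are proposition letters). $\overline\varphi$ denotes the dual (negation) of $\varphi$, and $\mathsf{Clos}^{\neg}(\Phi)$ is the Fischer–Ladner closure of $\Phi$ together with the duals of its members. The priority $\Omega(\varphi)$ is $1$ if $\varphi$ is not a fixpoint formula; $\Omega(\mu x.\varphi)$ (respectively $\Omega(\nu x.\varphi)$) is the least positive even (respectively odd) number that is at least the priority of every fixpoint subformula of $\varphi$ in which $x$ is free. **Semantics.** A model $\mathbb S$ interprets letters by sets of states and actions by relations with $R_{\breve a}=R_a^{-1}$. In the evaluation game on $\mathbb S$, with positions $(\varphi,s)$, player $\exists$ moves at disjunctions and diamonds, $\forall$ moves at conjunctions and boxes, fixpoint formulas are unfolded, and $\exists$ (respectively $\forall$) is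 stuck at false (respectively true) literals and constants. A player who is stuck loses; an infinite match is won by $\exists$ iff the maximal priority that occurs infinitely often is odd. A strategy $f$ for $\exists$ is *optimal* if it is winning from every position from which $\exists$ has a winning strategy. A *sequent* is a finite set of formulas, trace atoms $\varphi\leadsto^k\psi$ and negated trace atoms $\varphi\not\leadsto^k\psi$ ($k\in\mathbb N$), read conjunctively. For a positional strategy $f$ for $\exists$: $\mathbb S,s\Vdash_f\varphi$ iff $f$ is winning from $(\varphi,s)$; $\mathbb S,s\Vdash_f\varphi\leadsto^k\psi$ iff there is an $f$-guided match $(\varphi,s)=(\varphi_0,s_0)\cdots(\varphi_n,s_n)=(\psi,s)$ with $n>0$ and $k=\max_{i<n}\Omega(\varphi_i)$; and $\mathbb S,s\Vdash_f\varphi\not\leadsto^k\psi$ iff there is none. $\Gamma$ is *satisfiable* if there are a model $\mathbb S$, a state $s$ and an optimal positional strategy $f$ for $\exists$ such that $\mathbb S,s\Vdash_f X$ for all $X\in\Gamma$; otherwise it is *unsatisfiable*. **The system $\mathsf{NW}^2$.** Write $\mathsf{Clos}^\neg(\Gamma)$ for $\mathsf{Clos}^\neg$ of the set of formulas that occur in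 $\Gamma$ (also within trace atoms). The axioms are all sequents of the form * $\varphi,\overline\varphi,\Gamma$; * $\bot,\Gamma$; * $\varphi\leadsto^k\psi,\ \varphi\not\leadsto^k\psi,\ \Gamma$; * $\varphi\leadsto^{2k}\varphi,\ \Gamma$. The rules are, from the conclusion to the premises (the context $\Gamma$ may contain the principal items): * from $\varphi_0\wedge\varphi_1,\Gamma$ to $\varphi_0,\varphi_1,\varphi_0\wedge\varphi_1\leadsto^1\varphi_0,\varphi_0\wedge\varphi_1\leadsto^1\varphi_1,\Gamma$; * from $\varphi_0\vee\varphi_1,\Gamma$ to the two premises $\varphi_i,\varphi_0\vee\varphi_1\leadsto^1\varphi_i,\Gamma$, $i=0,1$; * for $\eta\in\{\mu,\nu\}$, from $\eta x.\varphi,\Gamma$ to $\varphi[\eta x.\varphi/x],\ \eta x.\varphi\leadsto^{\Omega(\eta x.\varphi)}\varphi[\eta x.\varphi/x],\ \Gamma$; * (trans) from $\varphi\leadsto^k\psi,\psi\leadsto^l\chi,\Gamma$ to $\varphi\leadsto^k\psi,\psi\leadsto^l\chi,\varphi\leadsto^{\max(k,l)}\chi,\Gamma$; * (cut) from $\Gamma$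 to $\varphi,\Gamma$ and $\overline\varphi,\Gamma$, where $\varphi\in\mathsf{Clos}^\neg(\Gamma)$; * (trace cut) from $\Gamma$ to $\varphi\leadsto^k\psi,\Gamma$ and $\varphi\not\leadsto^k\psi,\Gamma$, where $\varphi,\psi\in\mathsf{Clos}^\neg(\Gamma)$; * (weakening) from $X,\Gamma$ to $\Gamma$; * (modal rule) from $\Delta=\langle a\rangle\varphi,[a]\Sigma,\Gamma$ to $\varphi,\Sigma,\langle\breve a\rangle\Gamma,\Gamma^{\langle a\rangle\varphi}$. Here $\langle\breve a\rangle\Gamma$ consists of the formulas $\langle\breve a\rangle\chi\in\mathsf{Clos}^\neg(\Delta)$ with $\chi\in\Gamma$; and $\Gamma^{\langle a\rangle\varphi}$ consists of the following items, where $\gamma$ is $\langle a\rangle\varphi$ with $\beta=\varphi$, or $\gamma$ is any formula $[a]\beta$, and where $[\breve a]\chi\in\mathsf{Clos}^\neg(\Delta)$: $[\breve a]\chi\leadsto^k\beta$ if $\chi\leadsto^k\gamma\in\Gamma$, and $\beta\not\leadsto^k[\breve a]\chi$ if $\gamma\not\leadsto^k\chi\in\Gamma$. A *proof* is a possibly infinite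 tree of sequents built from these rules in which all leaves are axioms and every infinite branch carries a *$\mu$-trail*. A trail on a branch is an infinite sequence of triples $(\varphi_i,\varphi_{i+1},k_i)$, starting at any node of the branch, each of which is either a *detour trace* at the current node (that is, $\varphi_i\leadsto^{k_i}\varphi_{i+1}$ belongs to its sequent) or an *upward trace* to the next node of the branch; it is a $\mu$-trail if the maximal weight $k_i$ that appears infinitely often is even. The upward traces of a rule instance are $(\varphi,\varphi,1)$ for formulas $\varphi$ in the context $\Gamma$ of a non-modal rule, $(\varphi_0\wedge\varphi_1,\varphi_i,1)$ for the $\wedge$-rule, $(\varphi_0\vee\varphi_1,\varphi_i,1)$ to the $i$-th premise of the $\vee$-rule, $(\eta x.\varphi,\varphi[\eta x.\varphi/x],\Omega(\eta x.\varphi))$ for the fixpoint rules, and $(\langle a\rangle\varphi,\varphi,1)$ and $([a]\sigma,\sigma,1)$, $\sigma\in\Sigma$, for the modal rule. **Theorem (Soundness of $\mathsf{NW}^2$).** Let $\Gamma$ be a sequent in which the target $\psi$ of every trace atom $\varphi\leadsto^k\psi\in\Gamma$ is *supported*, where the supported formulas are the formulas in $\Gamma$ and, inductively, the targets of trace atoms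 in $\Gamma$ with a supported source. (In particular $\Gamma$ may be any set of formulas and negated trace atoms, or any sequent that contains the source of each of its trace atoms.) If $\Gamma$ is derivable in $\mathsf{NW}^2$, then $\Gamma$ is unsatisfiable. -/

import Mathlib

/-! # The two-way modal μ-calculus, trace atoms and the non-wellfounded system `NW²` -/

open Filter

universe u v w

namespace TwoWayMu

/-- A set of actions with the converse operation `a ↦ ă`. -/
class ConverseActions (A : Type v) where
  conv : A → A
  conv_conv : ∀ a, conv (conv a) = a

/-! ## Formulas -/

/-- Formulas in negation normal form with at most `n` free fixpoint variables (well-scoped de Bruijn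
indices, so that bound variables need no names). Negation applies to proposition letters only, so
that bound variables occur positively. -/
inductive Fm (P : Type u) (A : Type v) : ℕ → Type (max u v)
  | bot {n : ℕ} : Fm P A n
  | top {n : ℕ} : Fm P A n
  | prop {n : ℕ} (p : P) : Fm P A n
  | nprop {n : ℕ} (p : P) : Fm P A n
  | var {n : ℕ} (i : Fin n) : Fm P A n
  | or {n : ℕ} (φ ψ : Fm P A n) : Fm P A n
  | and {n : ℕ} (φ ψ : Fm P A n) : Fm P A n
  | dia {n : ℕ} (a : A) (φ : Fm P A n) : Fm P A n
  | box {n : ℕ} (a : A) (φ : Fm P A n) : Fm P A n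
  | mu {n : ℕ} (φ : Fm P A (n + 1)) : Fm P A n
  | nu {n : ℕ} (φ : Fm P A (n + 1)) : Fm P A n

/-- The formulas that occur in games, sequents and proofs: no unbound fixpoint variable (free
variables in the usual named presentation are proposition letters). -/
abbrev Sentence (P : Type u) (A : Type v) : Type (max u v) := Fm P A 0

namespace Fm

variable {P : Type u} {A : Type v}

/-- The renaming `ρ` extended under one binder. -/
def liftRen {n m : ℕ} (ρ : Fin n → Fin m) : Fin (n + 1) → Fin (m + 1) :=
  Fin.cases 0 (fun i => (ρ i).succ)

def rename : {n m : ℕ} → (Fin n → Fin m) → Fm P A n → Fm P A m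
  | _, _, _, bot => bot
  | _, _, _, top => top
  | _, _, _, prop p => prop p
  | _, _, _, nprop p => nprop p
  | _, _, ρ, var i => var (ρ i)
  | _, _, ρ, or φ ψ => or (rename ρ φ) (rename ρ ψ)
  | _, _, ρ, and φ ψ => and (rename ρ φ) (rename ρ ψ)
  | _, _, ρ, dia a φ => dia a (rename ρ φ)
  | _, _, ρ, box a φ => box a (rename ρ φ)
  | _, _, ρ, mu φ => mu (rename (liftRen ρ) φ)
  | _, _, ρ, nu φ => nu (rename (liftRen ρ) φ)

/-- The substitution `σ` extended under one binder. -/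
def liftSub {n m : ℕ} (σ : Fin n → Fm P A m) : Fin (n + 1) → Fm P A (m + 1) :=
  Fin.cases (var 0) (fun i => rename Fin.succ (σ i))

/-- Simultaneous (capture-avoiding) substitution. -/
def subst : {n m : ℕ} → (Fin n → Fm P A m) → Fm P A n → Fm P A m
  | _, _, _, bot => bot
  | _, _, _, top => top
  | _, _, _, prop p => prop p
  | _, _, _, nprop p => nprop p
  | _, _, σ, var i => σ i
  | _, _, σ, or φ ψ => or (subst σ φ) (subst σ ψ)
  | _, _, σ, and φ ψ => and (subst σ φ) (subst σ ψ)
  | _, _, σ, dia a φ => dia a (subst σ φ)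
  | _, _, σ, box a φ => box a (subst σ φ)
  | _, _, σ, mu φ => mu (subst (liftSub σ) φ)
  | _, _, σ, nu φ => nu (subst (liftSub σ) φ)

/-- The unfolding `φ[μx.φ / x]` of `μx.φ`. -/
def unfoldMu (φ : Fm P A 1) : Sentence P A := subst (fun _ => mu φ) φ

/-- The unfolding `φ[νx.φ / x]` of `νx.φ`. -/
def unfoldNu (φ : Fm P A 1) : Sentence P A := subst (fun _ => nu φ) φ

/-- The negation (dual) of a formula. -/
def neg : {n : ℕ} → Fm P A n → Fm P A n
  | _, bot => top
  | _, top => bot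
  | _, prop p => nprop p
  | _, nprop p => prop p
  | _, var i => var i
  | _, or φ ψ => and (neg φ) (neg ψ)
  | _, and φ ψ => or (neg φ) (neg ψ)
  | _, dia a φ => box a (neg φ)
  | _, box a φ => dia a (neg φ)
  | _, mu φ => nu (neg φ)
  | _, nu φ => mu (neg φ)

/-! ### Priorities

Only fixpoint formulas have a significant priority: `μ`-formulas have even and `ν`-formulas odd
priority, all other formulas have priority `1`. The priority of `ηx.φ` is the least number of the
right parity that is at least the priority of every fixpoint subformula of `φ` in which `x` occurs
freely (that is, of every inner fixpoint that depends on `x`). -/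

/-- The free variable `i` occurs in the formula. -/
def occurs : {n : ℕ} → Fm P A n → Fin n → Bool
  | _, bot, _ => false
  | _, top, _ => false
  | _, prop _, _ => false
  | _, nprop _, _ => false
  | _, var j, i => decide (j = i)
  | _, or φ ψ, i => occurs φ i || occurs ψ i
  | _, and φ ψ, i => occurs φ i || occurs ψ i
  | _, dia _ φ, i => occurs φ i
  | _, box _ φ, i => occurs φ i
  | _, mu φ, i => occurs φ i.succ
  | _, nu φ, i => occurs φ i.succ

/-- The least positive even number that is at least `m`. -/
def evenAbove (m : ℕ) : ℕ := max 2 (m + m % 2)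

/-- The least odd number that is at least `m`. -/
def oddAbove (m : ℕ) : ℕ := m + (m + 1) % 2

/-- The maximal priority of a fixpoint subformula in which the variable `i` occurs freely (`0` if
there is none). -/
def depPriority : {n : ℕ} → Fm P A n → Fin n → ℕ
  | _, bot, _ => 0
  | _, top, _ => 0
  | _, prop _, _ => 0
  | _, nprop _, _ => 0
  | _, var _, _ => 0
  | _, or φ ψ, i => max (depPriority φ i) (depPriority ψ i)
  | _, and φ ψ, i => max (depPriority φ i) (depPriority ψ i)
  | _, dia _ φ, i => depPriority φ i
  | _, box _ φ, i => depPriority φ i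
  | _, mu φ, i =>
      if occurs φ i.succ then max (evenAbove (depPriority φ 0)) (depPriority φ i.succ) else 0
  | _, nu φ, i =>
      if occurs φ i.succ then max (oddAbove (depPriority φ 0)) (depPriority φ i.succ) else 0

/-- The priority function `Ω`. -/
def priority {n : ℕ} : Fm P A n → ℕ
  | mu φ => evenAbove (depPriority φ 0)
  | nu φ => oddAbove (depPriority φ 0)
  | _ => 1

end Fm

variable {P : Type u} {A : Type v}

/-- The (Fischer–Ladner) closure `Clos(Φ)` of a set of formulas. -/
inductive Clos (Φ : Set (Sentence P A)) : Sentence P A → Prop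
  | base {φ : Sentence P A} : φ ∈ Φ → Clos Φ φ
  | or_left {φ ψ : Sentence P A} : Clos Φ (φ.or ψ) → Clos Φ φ
  | or_right {φ ψ : Sentence P A} : Clos Φ (φ.or ψ) → Clos Φ ψ
  | and_left {φ ψ : Sentence P A} : Clos Φ (φ.and ψ) → Clos Φ φ
  | and_right {φ ψ : Sentence P A} : Clos Φ (φ.and ψ) → Clos Φ ψ
  | dia {a : A} {φ : Sentence P A} : Clos Φ (φ.dia a) → Clos Φ φ
  | box {a : A} {φ : Sentence P A} : Clos Φ (φ.box a) → Clos Φ φ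
  | mu {φ : Fm P A 1} : Clos Φ φ.mu → Clos Φ φ.unfoldMu
  | nu {φ : Fm P A 1} : Clos Φ φ.nu → Clos Φ φ.unfoldNu

/-- `Clos^¬(Φ)`: the closure of `Φ` together with the negations of its members. -/
def ClosNeg (Φ : Set (Sentence P A)) : Set (Sentence P A) :=
  {φ | Clos Φ φ ∨ ∃ ψ, Clos Φ ψ ∧ φ = ψ.neg}

/-! ## Models and the evaluation game -/

/-- Kripke models in which `ă` is interpreted as the converse of `a`. -/
structure Model (P : Type u) (A : Type v) [ConverseActions A] where
  State : Type w
  R : A → State → State → Prop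
  V : P → Set State
  conv_iff : ∀ a s t, R (ConverseActions.conv a) s t ↔ R a t s

section Game

variable [ConverseActions A]

/-- Positions `(φ, s)` of the evaluation game on `M`. -/
abbrev Pos (M : Model.{u, v, w} P A) : Type (max u v w) := Sentence P A × M.State

/-- The positions owned by `∃`; all others are owned by `∀` (the owner of a position with exactly
one move, such as those of fixpoint formulas, is immaterial). -/
def EloiseOwns (M : Model.{u, v, w} P A) : Pos M → Prop
  | (.bot, _) => True
  | (.prop p, s) => s ∉ M.V p
  | (.nprop p, s) => s ∈ M.V p
  | (.or _ _, _) => True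
  | (.dia _ _, _) => True
  | _ => False

/-- The admissible moves of the evaluation game. -/
inductive Move (M : Model.{u, v, w} P A) : Pos M → Pos M → Prop
  | or_left (φ ψ : Sentence P A) (s : M.State) : Move M (φ.or ψ, s) (φ, s)
  | or_right (φ ψ : Sentence P A) (s : M.State) : Move M (φ.or ψ, s) (ψ, s)
  | and_left (φ ψ : Sentence P A) (s : M.State) : Move M (φ.and ψ, s) (φ, s)
  | and_right (φ ψ : Sentence P A) (s : M.State) : Move M (φ.and ψ, s) (ψ, s)
  | dia {a : A} (φ : Sentence P A) {s t : M.State} : M.R a s t → Move M (φ.dia a, s) (φ, t)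
  | box {a : A} (φ : Sentence P A) {s t : M.State} : M.R a s t → Move M (φ.box a, s) (φ, t)
  | mu (φ : Fm P A 1) (s : M.State) : Move M (φ.mu, s) (φ.unfoldMu, s)
  | nu (φ : Fm P A 1) (s : M.State) : Move M (φ.nu, s) (φ.unfoldNu, s)

/-- Strategies for `∃`: `move h v` is her choice at the position `v` after the sequence `h` of
earlier positions. It is an admissible move whenever there is one. -/
structure Strategy (M : Model.{u, v, w} P A) where
  move : List (Pos M) → Pos M → Pos M
  legal : ∀ h v, EloiseOwns M v → (∃ v', Move M v v') → Move M v (move h v)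

/-- A strategy is positional if it does not depend on the earlier positions. -/
def Strategy.Positional {M : Model.{u, v, w} P A} (f : Strategy M) : Prop :=
  ∀ h h' v, f.move h v = f.move h' v

/-- `π 0, …, π n` is a partial match guided by `f`. -/
def Strategy.Guides {M : Model.{u, v, w} P A} (f : Strategy M) (π : ℕ → Pos M) (n : ℕ) : Prop :=
  ∀ i < n, Move M (π i) (π (i + 1)) ∧
    (EloiseOwns M (π i) → π (i + 1) = f.move ((List.range i).map π) (π i))

/-- The maximal number that occurs infinitely often in the sequence `k` is `K`. -/
def LimMax (k : ℕ → ℕ) (K : ℕ) : Prop :=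
  (∃ᶠ i in atTop, k i = K) ∧ ∀ᶠ i in atTop, k i ≤ K

/-- `f` is winning for `∃` from `v`: she wins all `f`-guided full matches that start at `v`. A
finite full match is lost by the owner of its last position, and an infinite match is won by `∃` if
and only if the maximal priority that occurs infinitely often is odd, i.e. belongs to a
`ν`-formula. -/
def Strategy.WinsFrom {M : Model.{u, v, w} P A} (f : Strategy M) (v : Pos M) : Prop :=
  (∀ (π : ℕ → Pos M) (n : ℕ), π 0 = v → f.Guides π n → (¬ ∃ v', Move M (π n) v') →
      ¬ EloiseOwns M (π n)) ∧
  (∀ π : ℕ → Pos M, π 0 = v → (∀ n, f.Guides π n) →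
      ∃ K, Odd K ∧ LimMax (fun i => (π i).1.priority) K)

/-- A strategy for `∃` is optimal if it is winning from every position from which `∃` has a winning
strategy at all. -/
def Strategy.Optimal {M : Model.{u, v, w} P A} (f : Strategy M) : Prop :=
  ∀ v, (∃ g : Strategy M, g.WinsFrom v) → f.WinsFrom v

end Game

/-! ## Sequents -/

/-- The members of sequents: formulas `φ`, trace atoms `φ ⇝ᵏ ψ` and negated trace atoms. -/
inductive Item (P : Type u) (A : Type v) : Type (max u v)
  | form (φ : Sentence P A) : Item P A
  | trace (φ : Sentence P A) (k : ℕ) (ψ : Sentence P A) : Item P A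
  | ntrace (φ : Sentence P A) (k : ℕ) (ψ : Sentence P A) : Item P A

/-- Sequents, read conjunctively; in proofs they are required to be finite. -/
abbrev Sequent (P : Type u) (A : Type v) : Type (max u v) := Set (Item P A)

/-- The formulas that occur in a sequent, as members or in its trace atoms. -/
def Sequent.formulas (Γ : Sequent P A) : Set (Sentence P A) :=
  {φ | Item.form φ ∈ Γ ∨ ∃ k ψ, Item.trace φ k ψ ∈ Γ ∨ Item.trace ψ k φ ∈ Γ ∨
    Item.ntrace φ k ψ ∈ Γ ∨ Item.ntrace ψ k φ ∈ Γ}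

/-- `Clos^¬(Γ)` for a sequent `Γ`. -/
def Sequent.closNeg (Γ : Sequent P A) : Set (Sentence P A) := ClosNeg Γ.formulas

/-- The formulas supported by `Γ`: members of `Γ`, and the targets of trace atoms of `Γ` whose source
is supported. -/
inductive Sequent.Supports (Γ : Sequent P A) : Sentence P A → Prop
  | mem {φ : Sentence P A} : Item.form φ ∈ Γ → Sequent.Supports Γ φ
  | step {φ ψ : Sentence P A} {k : ℕ} :
      Sequent.Supports Γ φ → Item.trace φ k ψ ∈ Γ → Sequent.Supports Γ ψ

section Satisfaction

variable [ConverseActions A]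

/-- There is an `f`-guided match `(φ, s) = (φ₀, s₀) ⋯ (φₙ, sₙ) = (ψ, s)` with `n > 0` and
`k = max {Ω(φᵢ) | i < n}`. -/
def HoldsTrace (M : Model.{u, v, w} P A) (f : Strategy M) (s : M.State)
    (φ : Sentence P A) (k : ℕ) (ψ : Sentence P A) : Prop :=
  ∃ (π : ℕ → Pos M) (n : ℕ), 0 < n ∧ π 0 = (φ, s) ∧ π n = (ψ, s) ∧ f.Guides π n ∧
    (Finset.range n).sup (fun i => (π i).1.priority) = k

/-- `M, s ⊩_f A` for a formula or a (negated) trace atom. -/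
def Item.Holds (M : Model.{u, v, w} P A) (f : Strategy M) (s : M.State) : Item P A → Prop
  | .form φ => f.WinsFrom (φ, s)
  | .trace φ k ψ => HoldsTrace M f s φ k ψ
  | .ntrace φ k ψ => ¬ HoldsTrace M f s φ k ψ

/-- `Γ` is satisfiable if `M, s ⊩_f Γ` for some pointed model `M, s` and some optimal positional
strategy `f` for `∃` in the evaluation game on `M`. -/
def Sequent.Satisfiable (Γ : Sequent P A) : Prop :=
  ∃ (M : Model.{u, v, w} P A) (s : M.State) (f : Strategy M),
    f.Positional ∧ f.Optimal ∧ ∀ X ∈ Γ, Item.Holds M f s X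

end Satisfaction

/-! ## The proof system `NW²` -/

section ProofSystem

variable [ConverseActions A]

open ConverseActions in
/-- The trace atoms `Γ^{⟨a⟩φ}` that the modal rule for `⟨a⟩φ` puts into its premise, where `Δ` is
the conclusion of the rule: for the principal formula `⟨a⟩φ` and for all formulas `[a]β`,
from `χ ⇝ᵏ ⟨a⟩φ` or `χ ⇝ᵏ [a]β` in `Γ` the atom `[ă]χ ⇝ᵏ φ` or `[ă]χ ⇝ᵏ β`, and
from the negation of `⟨a⟩φ ⇝ᵏ χ` or `[a]β ⇝ᵏ χ` in `Γ` that of `φ ⇝ᵏ [ă]χ` or `β ⇝ᵏ [ă]χ`,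
provided that `[ă]χ` lies in `Clos^¬(Δ)`. -/
inductive JumpAtoms (a : A) (φ : Sentence P A) (Γ Δ : Sequent P A) : Item P A → Prop
  | trace_dia {χ : Sentence P A} {k : ℕ} : Item.trace χ k (φ.dia a) ∈ Γ →
      χ.box (conv a) ∈ Δ.closNeg → JumpAtoms a φ Γ Δ (.trace (χ.box (conv a)) k φ)
  | trace_box {χ β : Sentence P A} {k : ℕ} : Item.trace χ k (β.box a) ∈ Γ →
      χ.box (conv a) ∈ Δ.closNeg → JumpAtoms a φ Γ Δ (.trace (χ.box (conv a)) k β)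
  | ntrace_dia {χ : Sentence P A} {k : ℕ} : Item.ntrace (φ.dia a) k χ ∈ Γ →
      χ.box (conv a) ∈ Δ.closNeg → JumpAtoms a φ Γ Δ (.ntrace φ k (χ.box (conv a)))
  | ntrace_box {χ β : Sentence P A} {k : ℕ} : Item.ntrace (β.box a) k χ ∈ Γ →
      χ.box (conv a) ∈ Δ.closNeg → JumpAtoms a φ Γ Δ (.ntrace β k (χ.box (conv a)))

/-- The conclusion `⟨a⟩φ, [a]Θ, Γ` of the modal rule. -/
def diaConclusion (a : A) (φ : Sentence P A) (Θ : Set (Sentence P A)) (Γ : Sequent P A) :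
    Sequent P A :=
  {Item.form (φ.dia a)} ∪ {X | ∃ σ ∈ Θ, X = Item.form (σ.box a)} ∪ Γ

open ConverseActions in
/-- The premise `φ, Θ, ⟨ă⟩Γ, Γ^{⟨a⟩φ}` of the modal rule, where `⟨ă⟩Γ` consists of the formulas `⟨ă⟩χ`
with `χ ∈ Γ` that lie in `Clos^¬` of the conclusion. -/
def diaPremise (a : A) (φ : Sentence P A) (Θ : Set (Sentence P A)) (Γ : Sequent P A) :
    Sequent P A :=
  {Item.form φ} ∪ {X | ∃ σ ∈ Θ, X = Item.form σ} ∪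
    {X | ∃ χ : Sentence P A, Item.form χ ∈ Γ ∧
      χ.dia (conv a) ∈ (diaConclusion a φ Θ Γ).closNeg ∧ X = Item.form (χ.dia (conv a))} ∪
    {X | JumpAtoms a φ Γ (diaConclusion a φ Θ Γ) X}

/-- Rule instances. The context `Γ` may contain the principal items as well. -/
inductive RuleInst (P : Type u) (A : Type v) [ConverseActions A] : Type (max u v)
  | ax1 (φ : Sentence P A) (Γ : Sequent P A)
  | ax2 (Γ : Sequent P A)
  | ax3 (φ : Sentence P A) (k : ℕ) (ψ : Sentence P A) (Γ : Sequent P A)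
  | ax4 (φ : Sentence P A) (k : ℕ) (Γ : Sequent P A)
  | and (φ ψ : Sentence P A) (Γ : Sequent P A)
  | or (φ ψ : Sentence P A) (Γ : Sequent P A)
  | mu (φ : Fm P A 1) (Γ : Sequent P A)
  | nu (φ : Fm P A 1) (Γ : Sequent P A)
  | dia (a : A) (φ : Sentence P A) (Θ : Set (Sentence P A)) (Γ : Sequent P A)
  | trans (φ : Sentence P A) (k : ℕ) (ψ : Sentence P A) (l : ℕ) (χ : Sentence P A)
      (Γ : Sequent P A)
  | cut (φ : Sentence P A) (Γ : Sequent P A) (hφ : φ ∈ Γ.closNeg)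
  | tcut (φ : Sentence P A) (k : ℕ) (ψ : Sentence P A) (Γ : Sequent P A)
      (hφ : φ ∈ Γ.closNeg) (hψ : ψ ∈ Γ.closNeg)
  | weak (X : Item P A) (Γ : Sequent P A)

namespace RuleInst

def conclusion : RuleInst P A → Sequent P A
  | ax1 φ Γ => {.form φ, .form φ.neg} ∪ Γ
  | ax2 Γ => {.form .bot} ∪ Γ
  | ax3 φ k ψ Γ => {.trace φ k ψ, .ntrace φ k ψ} ∪ Γ
  | ax4 φ k Γ => {.trace φ (2 * k) φ} ∪ Γ
  | and φ ψ Γ => {.form (φ.and ψ)} ∪ Γ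
  | or φ ψ Γ => {.form (φ.or ψ)} ∪ Γ
  | mu φ Γ => {.form φ.mu} ∪ Γ
  | nu φ Γ => {.form φ.nu} ∪ Γ
  | dia a φ Θ Γ => diaConclusion a φ Θ Γ
  | trans φ k ψ l χ Γ => {.trace φ k ψ, .trace ψ l χ} ∪ Γ
  | cut _ Γ _ => Γ
  | tcut _ _ _ Γ _ _ => Γ
  | weak X Γ => {X} ∪ Γ

def premises : RuleInst P A → List (Sequent P A)
  | ax1 _ _ => []
  | ax2 _ => []
  | ax3 _ _ _ _ => []
  | ax4 _ _ _ => []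
  | and φ ψ Γ => [{.form φ, .form ψ, .trace (φ.and ψ) 1 φ, .trace (φ.and ψ) 1 ψ} ∪ Γ]
  | or φ ψ Γ => [{.form φ, .trace (φ.or ψ) 1 φ} ∪ Γ, {.form ψ, .trace (φ.or ψ) 1 ψ} ∪ Γ]
  | mu φ Γ => [{.form φ.unfoldMu, .trace φ.mu (Fm.priority φ.mu) φ.unfoldMu} ∪ Γ]
  | nu φ Γ => [{.form φ.unfoldNu, .trace φ.nu (Fm.priority φ.nu) φ.unfoldNu} ∪ Γ]
  | dia a φ Θ Γ => [diaPremise a φ Θ Γ]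
  | trans φ k ψ l χ Γ => [{.trace φ k ψ, .trace ψ l χ, .trace φ (max k l) χ} ∪ Γ]
  | cut φ Γ _ => [{.form φ} ∪ Γ, {.form φ.neg} ∪ Γ]
  | tcut φ k ψ Γ _ _ => [{.trace φ k ψ} ∪ Γ, {.ntrace φ k ψ} ∪ Γ]
  | weak _ Γ => [Γ]

/-- The traces `(φ, φ, 1)` of formulas in the context. -/
def SideTrace (Γ : Sequent P A) (φ ψ : Sentence P A) (k : ℕ) : Prop :=
  Item.form φ ∈ Γ ∧ ψ = φ ∧ k = 1

/-- `r.UpTrace i φ ψ k`: the triple `(φ, ψ, k)` is an upward trace from the conclusion of `r` to its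
premise number `i`. -/
def UpTrace : RuleInst P A → ℕ → Sentence P A → Sentence P A → ℕ → Prop
  | and α β Γ, _, φ, ψ, k => SideTrace Γ φ ψ k ∨ (φ = α.and β ∧ (ψ = α ∨ ψ = β) ∧ k = 1)
  | or α β Γ, i, φ, ψ, k => SideTrace Γ φ ψ k ∨
      (φ = α.or β ∧ ((i = 0 ∧ ψ = α) ∨ (i = 1 ∧ ψ = β)) ∧ k = 1)
  | mu α Γ, _, φ, ψ, k => SideTrace Γ φ ψ k ∨
      (φ = α.mu ∧ ψ = α.unfoldMu ∧ k = Fm.priority α.mu)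
  | nu α Γ, _, φ, ψ, k => SideTrace Γ φ ψ k ∨
      (φ = α.nu ∧ ψ = α.unfoldNu ∧ k = Fm.priority α.nu)
  | dia a α Θ _, _, φ, ψ, k =>
      ((φ = α.dia a ∧ ψ = α) ∨ (ψ ∈ Θ ∧ φ = ψ.box a)) ∧ k = 1
  | trans _ _ _ _ _ Γ, _, φ, ψ, k => SideTrace Γ φ ψ k
  | cut _ Γ _, _, φ, ψ, k => SideTrace Γ φ ψ k
  | tcut _ _ _ Γ _ _, _, φ, ψ, k => SideTrace Γ φ ψ k
  | weak _ Γ, _, φ, ψ, k => SideTrace Γ φ ψ k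
  | _, _, _, _, _ => False

end RuleInst

/-- A possibly infinite derivation, given by rule instances at the nodes of a tree; a node is the
list of premise numbers that leads to it from the root. Only the values of `rule` at nodes of the
tree matter. -/
structure Derivation (P : Type u) (A : Type v) [ConverseActions A] where
  rule : List ℕ → RuleInst P A

namespace Derivation

/-- The nodes of the derivation tree. -/
inductive Node (D : Derivation P A) : List ℕ → Prop
  | root : Node D []
  | child {x : List ℕ} {i : ℕ} : Node D x → i < (D.rule x).premises.length → Node D (x ++ [i])

/-- The sequent at a node. -/
def sequent (D : Derivation P A) (x : List ℕ) : Sequent P A := (D.rule x).conclusion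

/-- Sequents are finite, and the children of a node carry the premises of its rule instance. -/
def WellFormed (D : Derivation P A) : Prop :=
  (∀ x, D.Node x → (D.sequent x).Finite) ∧
  ∀ x, D.Node x → ∀ (i : ℕ) (h : i < (D.rule x).premises.length),
    D.sequent (x ++ [i]) = (D.rule x).premises[i]

/-- The `n`-th node of the branch that chooses the premises `b 0, b 1, …`. -/
def nodeAt (b : ℕ → ℕ) (n : ℕ) : List ℕ := (List.range n).map b

/-- `b` is an infinite branch. -/
def IsBranch (D : Derivation P A) (b : ℕ → ℕ) : Prop := ∀ n, D.Node (nodeAt b n)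

/-- The sequence of triples `(φᵢ, φᵢ₊₁, kᵢ)`, located at the `dᵢ`-th node of the branch `b`, is an
infinite trail: every triple is a detour trace, given by a trace atom in the sequent of the current
node, or an upward trace to the next node of the branch. A trail may start anywhere. -/
def IsTrail (D : Derivation P A) (b : ℕ → ℕ) (d : ℕ → ℕ) (φ : ℕ → Sentence P A) (k : ℕ → ℕ) :
    Prop :=
  ∀ i,
    (d (i + 1) = d i ∧ Item.trace (φ i) (k i) (φ (i + 1)) ∈ D.sequent (nodeAt b (d i))) ∨
    (d (i + 1) = d i + 1 ∧
      (D.rule (nodeAt b (d i))).UpTrace (b (d i)) (φ i) (φ (i + 1)) (k i))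

/-- The branch `b` carries a `μ`-trail: a trail on which the maximal weight that appears infinitely
often is even. -/
def HasMuTrail (D : Derivation P A) (b : ℕ → ℕ) : Prop :=
  ∃ (d : ℕ → ℕ) (φ : ℕ → Sentence P A) (k : ℕ → ℕ),
    D.IsTrail b d φ k ∧ ∃ K, Even K ∧ LimMax k K

/-- An `NW²`-proof: a derivation (whose leaves are axioms, the rule instances without premises) in
which every infinite branch carries a `μ`-trail. -/
def IsProof (D : Derivation P A) : Prop :=
  D.WellFormed ∧ ∀ b, D.IsBranch b → D.HasMuTrail b

end Derivation

/-- `NW² ⊢ Γ`. -/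
def NW2Derivable (Γ : Sequent P A) : Prop :=
  ∃ D : Derivation P A, D.IsProof ∧ D.sequent [] = Γ

end ProofSystem

end TwoWayMu

namespace TwoWayMu

variable {P : Type u} {A : Type v}

namespace Fm

/-! ### Substitution and negation -/

/-! Suppose that the root of a proof holds at some state under an optimal positional strategy `f`.
Every rule instance whose conclusion holds has a premise that holds, at the same state or, for the
modal rule, at the state that `f` chooses (`exists_sat_premise`). Axioms cannot hold, so an infinite
branch of true sequents arises. Its μ-trail is a chain of `f`-guided matches: a detour is a match
that returns to its state, an upward trace is a move or a pause. Their concatenation is an infinite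
`f`-guided match from a winning position with an even maximal recurring priority, which is absurd
(`WinsFrom.not_even_of_link`).

The invariant cannot be plain truth: a trace atom may be witnessed by a match through losing
positions, where loops of even weight are possible. `Item.Sat` therefore also asks that `f` wins
from the target of a trace atom, and weakens negated atoms accordingly, so that trace cut remains an
exact case distinction. Support of the targets makes a satisfied root sequent meet this invariant
(`sat_of_holds`).

Optimality enters where truth is not read off from the moves of `f`: in the backward diamonds of the
modal rule and in cut. Cut also needs that `∃` wins from a formula or from its negation
(`exists_winsFrom_or_neg`). This follows from positional determinacy of parity games once a strategy
of `∀` is read as a strategy of `∃` for the negated formulas. The axiom of complementary formulas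
needs the converse, that `f` never wins from both (`WinsFrom.not_negPos`).

Both facts require that a match and its negation have opposite winners. Negation does not shift
priorities uniformly, so this is not immediate. It holds because in every infinite match some
recurring fixpoint formula eventually bounds all priorities, and its negation eventually bounds the
negated ones (`dominated_of_succ`). -/

theorem liftRen_comp {n m l : ℕ} (ρ : Fin n → Fin m) (τ : Fin m → Fin l) :
    liftRen (fun i => τ (ρ i)) = fun i => liftRen τ (liftRen ρ i) := by
  funext i; refine Fin.cases ?_ (fun i => ?_) i <;> simp [liftRen]

theorem liftSub_comp_liftRen {n m l : ℕ} (ρ : Fin n → Fin m) (τ : Fin m → Fm P A l) :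
    liftSub (fun i => τ (ρ i)) = fun i => liftSub τ (liftRen ρ i) := by
  funext i; refine Fin.cases ?_ (fun i => ?_) i <;> simp [liftRen, liftSub]

theorem liftSub_var {n : ℕ} : liftSub (var : Fin n → Fm P A n) = var := by
  funext i; refine Fin.cases ?_ (fun i => ?_) i <;> simp [liftSub, rename]

theorem rename_rename {n m l : ℕ} (φ : Fm P A n) (ρ : Fin n → Fin m) (τ : Fin m → Fin l) :
    rename τ (rename ρ φ) = rename (fun i => τ (ρ i)) φ := by
  induction φ generalizing m l <;> simp_all [rename, liftRen_comp]

theorem subst_rename {n m l : ℕ} (φ : Fm P A n) (ρ : Fin n → Fin m) (τ : Fin m → Fm P A l) :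
    subst τ (rename ρ φ) = subst (fun i => τ (ρ i)) φ := by
  induction φ generalizing m l <;> simp_all [rename, subst, liftSub_comp_liftRen]

theorem liftSub_rename {n m l : ℕ} (σ : Fin n → Fm P A m) (ρ : Fin m → Fin l) :
    liftSub (fun i => rename ρ (σ i)) = fun i => rename (liftRen ρ) (liftSub σ i) := by
  funext i
  refine Fin.cases ?_ (fun i => ?_) i <;> simp [liftRen, liftSub, rename, rename_rename]

theorem rename_subst {n m l : ℕ} (φ : Fm P A n) (σ : Fin n → Fm P A m) (ρ : Fin m → Fin l) :
    rename ρ (subst σ φ) = subst (fun i => rename ρ (σ i)) φ := by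
  induction φ generalizing m l <;> simp_all [rename, subst, liftSub_rename]

theorem liftSub_subst {n m l : ℕ} (σ : Fin n → Fm P A m) (τ : Fin m → Fm P A l) :
    liftSub (fun i => subst τ (σ i)) = fun i => subst (liftSub τ) (liftSub σ i) := by
  funext i
  refine Fin.cases ?_ (fun i => ?_) i <;>
    simp [liftSub, subst, rename_subst, subst_rename]

theorem subst_subst {n m l : ℕ} (φ : Fm P A n) (σ : Fin n → Fm P A m) (τ : Fin m → Fm P A l) :
    subst τ (subst σ φ) = subst (fun i => subst τ (σ i)) φ := by
  induction φ generalizing m l <;> simp_all [subst, liftSub_subst]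

theorem subst_var {n : ℕ} (φ : Fm P A n) : subst var φ = φ := by
  induction φ <;> simp_all [subst, liftSub_var]

theorem subst_sentence (φ : Sentence P A) (σ : Fin 0 → Sentence P A) : subst σ φ = φ := by
  rw [Subsingleton.elim σ var, subst_var]

/-- Unfolding a closed instance of a fixpoint formula. -/
theorem subst_liftSub {n : ℕ} (φ : Fm P A (n + 1)) (σ : Fin n → Sentence P A)
    (ξ : Sentence P A) :
    subst (fun _ => ξ) (subst (liftSub σ) φ) = subst (Fin.cases ξ σ) φ := by
  rw [subst_subst]
  congr 1
  funext i
  refine Fin.cases ?_ (fun i => ?_) i <;> simp [liftSub, subst, subst_rename, subst_sentence]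

theorem neg_neg {n : ℕ} (φ : Fm P A n) : φ.neg.neg = φ := by
  induction φ <;> simp_all [neg]

theorem neg_rename {n m : ℕ} (φ : Fm P A n) (ρ : Fin n → Fin m) :
    (rename ρ φ).neg = rename ρ φ.neg := by
  induction φ generalizing m <;> simp_all [neg, rename]

theorem neg_liftSub {n m : ℕ} (σ : Fin n → Fm P A m) :
    liftSub (fun i => (σ i).neg) = fun i => (liftSub σ i).neg := by
  funext i; refine Fin.cases ?_ (fun i => ?_) i <;> simp [liftSub, neg, neg_rename]

theorem neg_subst {n m : ℕ} (φ : Fm P A n) (σ : Fin n → Fm P A m) :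
    (subst σ φ).neg = subst (fun i => (σ i).neg) φ.neg := by
  induction φ generalizing m <;> simp_all [neg, subst, neg_liftSub]

theorem neg_unfoldMu (φ : Fm P A 1) : φ.unfoldMu.neg = φ.neg.unfoldNu := by
  simp [unfoldMu, unfoldNu, neg_subst, neg]

theorem neg_unfoldNu (φ : Fm P A 1) : φ.unfoldNu.neg = φ.neg.unfoldMu := by
  simp [unfoldMu, unfoldNu, neg_subst, neg]

/-! ### Priorities -/

theorem occurs_rename {n m : ℕ} (φ : Fm P A n) (ρ : Fin n → Fin m) (i : Fin m) :
    occurs (rename ρ φ) i = true ↔ ∃ j, ρ j = i ∧ occurs φ j = true := by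
  induction φ generalizing m with
  | bot | top | prop | nprop => simp [rename, occurs]
  | var j => simp [rename, occurs]
  | or φ ψ h₁ h₂ | and φ ψ h₁ h₂ =>
    simp only [rename, occurs, Bool.or_eq_true, h₁, h₂]; grind
  | dia a φ h | box a φ h => simp [rename, occurs, h]
  | mu φ h | nu φ h =>
    simp only [rename, occurs, h]
    constructor
    · rintro ⟨j, hj, ho⟩
      induction j using Fin.cases with
      | zero => simp [liftRen, Fin.ext_iff] at hj
      | succ j => exact ⟨j, by simpa [liftRen] using hj, ho⟩
    · rintro ⟨j, hj, ho⟩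
      exact ⟨j.succ, by simp [liftRen, hj], ho⟩

theorem occurs_rename_succ {n : ℕ} (φ : Fm P A n) (i : Fin n) :
    occurs (rename Fin.succ φ) i.succ = occurs φ i := by
  rw [Bool.eq_iff_iff, occurs_rename]; simp

theorem occurs_rename_zero {n : ℕ} (φ : Fm P A n) : occurs (rename Fin.succ φ) 0 = false := by
  rw [Bool.eq_false_iff, ne_eq, occurs_rename]; simp [Fin.succ_ne_zero]

theorem depPriority_eq_zero {n : ℕ} (φ : Fm P A n) (i : Fin n) (h : occurs φ i = false) :
    depPriority φ i = 0 := by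
  induction φ <;> simp_all [occurs, depPriority]

/-- The variable `i` of an instance `φ[σ]` stems from the variable `j` of `φ` only. -/
def OnlyFrom {n m : ℕ} (σ : Fin n → Fm P A m) (j : Fin n) (i : Fin m) : Prop :=
  σ j = var i ∧ ∀ j' ≠ j, occurs (σ j') i = false

theorem onlyFrom_liftSub_zero {n m : ℕ} (σ : Fin n → Fm P A m) : OnlyFrom (liftSub σ) 0 0 := by
  refine ⟨rfl, fun j => Fin.cases (by simp) (fun j _ => ?_) j⟩
  simpa [liftSub] using occurs_rename_zero (σ j)

theorem OnlyFrom.liftSub {n m : ℕ} {σ : Fin n → Fm P A m} {j : Fin n} {i : Fin m}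
    (h : OnlyFrom σ j i) : OnlyFrom (liftSub σ) j.succ i.succ := by
  refine ⟨by simp [Fm.liftSub, h.1, rename], fun j' => Fin.cases (fun _ => ?_) (fun j' hj => ?_) j'⟩
  · simp [Fm.liftSub, occurs, Fin.ext_iff]
  · simpa [Fm.liftSub, occurs_rename_succ] using h.2 j' (by simpa using hj)

/-- The priority of an inner fixpoint depends on its own bound variable. Under a binder the
induction hypothesis is thus needed twice: for the shifted variable and for the new variable `0`. -/
theorem OnlyFrom.occurs_depPriority {n m : ℕ} (φ : Fm P A n) {σ : Fin n → Fm P A m} {j : Fin n}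
    {i : Fin m} (h : OnlyFrom σ j i) :
    occurs (subst σ φ) i = occurs φ j ∧ depPriority (subst σ φ) i = depPriority φ j := by
  induction φ generalizing m with
  | bot | top | prop | nprop => simp [subst, occurs, depPriority]
  | var j' =>
    by_cases hj : j' = j
    · subst hj; simp [subst, h.1, occurs, depPriority]
    · simp [subst, occurs, depPriority, h.2 j' hj, hj, depPriority_eq_zero]
  | or φ ψ h₁ h₂ | and φ ψ h₁ h₂ => simp [subst, occurs, depPriority, h₁ h, h₂ h]
  | dia a φ h₁ | box a φ h₁ => simp [subst, occurs, depPriority, h₁ h]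
  | mu φ h₁ | nu φ h₁ =>
    simp [subst, occurs, depPriority, h₁ h.liftSub, h₁ (onlyFrom_liftSub_zero σ)]

/-- The substituted formulas cannot contain the bound variable, so a fixpoint formula and its
instances have equal priority. -/
theorem depPriority_subst_liftSub {n m : ℕ} (φ : Fm P A (n + 1)) (σ : Fin n → Fm P A m) :
    depPriority (subst (liftSub σ) φ) 0 = depPriority φ 0 :=
  ((onlyFrom_liftSub_zero σ).occurs_depPriority φ).2

theorem rename_eq_subst {n m : ℕ} (φ : Fm P A n) (ρ : Fin n → Fin m) :
    rename ρ φ = subst (fun i => var (ρ i)) φ := by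
  conv_lhs => rw [← subst_var (rename ρ φ), subst_rename]

theorem le_evenAbove (m : ℕ) : m ≤ evenAbove m := by unfold evenAbove; omega
theorem le_oddAbove (m : ℕ) : m ≤ oddAbove m := by unfold oddAbove; omega
theorem one_le_evenAbove (m : ℕ) : 1 ≤ evenAbove m := by unfold evenAbove; omega
theorem one_le_oddAbove (m : ℕ) : 1 ≤ oddAbove m := by unfold oddAbove; omega
theorem even_evenAbove (m : ℕ) : Even (evenAbove m) := by
  rw [Nat.even_iff]; unfold evenAbove; omega
theorem odd_oddAbove (m : ℕ) : Odd (oddAbove m) := by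
  rw [Nat.odd_iff]; unfold oddAbove; omega

theorem one_le_priority {n : ℕ} (φ : Fm P A n) : 1 ≤ priority φ := by
  cases φ <;> simp [priority, one_le_evenAbove, one_le_oddAbove]

/-- The maximal priority of a subformula. -/
def maxPriority : {n : ℕ} → Fm P A n → ℕ
  | _, or φ ψ => max (maxPriority φ) (maxPriority ψ)
  | _, and φ ψ => max (maxPriority φ) (maxPriority ψ)
  | _, dia _ φ => maxPriority φ
  | _, box _ φ => maxPriority φ
  | _, mu φ => max (evenAbove (depPriority φ 0)) (maxPriority φ)
  | _, nu φ => max (oddAbove (depPriority φ 0)) (maxPriority φ)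
  | _, _ => 1

theorem one_le_maxPriority {n : ℕ} (φ : Fm P A n) : 1 ≤ maxPriority φ := by
  induction φ <;> simp_all [maxPriority]

theorem priority_le_maxPriority {n : ℕ} (φ : Fm P A n) : priority φ ≤ maxPriority φ := by
  cases φ <;> simp [priority, maxPriority, one_le_maxPriority]

theorem maxPriority_rename {n m : ℕ} (φ : Fm P A n) (ρ : Fin n → Fin m) :
    maxPriority (rename ρ φ) = maxPriority φ := by
  have key : ∀ {n m : ℕ} (φ : Fm P A (n + 1)) (ρ : Fin n → Fin m),
      depPriority (rename (liftRen ρ) φ) 0 = depPriority φ 0 := by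
    intro n m φ ρ
    rw [← depPriority_subst_liftSub φ fun i => var (ρ i), rename_eq_subst]
    congr 2
    funext i; refine Fin.cases ?_ (fun i => ?_) i <;> simp [liftRen, liftSub, rename]
  induction φ generalizing m <;> simp_all [maxPriority, rename]

/-- Instantiation creates no new priorities. Hence unfolding never raises the maximum, and the
priorities in a match are bounded by its initial formula. -/
theorem maxPriority_subst_le {n m : ℕ} (φ : Fm P A n) (σ : Fin n → Fm P A m) {B : ℕ}
    (hφ : maxPriority φ ≤ B) (hσ : ∀ i, maxPriority (σ i) ≤ B) : maxPriority (subst σ φ) ≤ B := by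
  induction φ generalizing m with
  | bot | top | prop | nprop => simpa [subst, maxPriority] using hφ
  | var i => exact hσ i
  | or φ ψ h₁ h₂ | and φ ψ h₁ h₂ =>
    simp only [maxPriority, max_le_iff, subst] at hφ ⊢
    exact ⟨h₁ σ hφ.1 hσ, h₂ σ hφ.2 hσ⟩
  | dia a φ h | box a φ h => exact h σ hφ hσ
  | mu φ h | nu φ h =>
    simp only [maxPriority, max_le_iff, subst, depPriority_subst_liftSub] at hφ ⊢
    refine ⟨hφ.1, h _ hφ.2 fun i => ?_⟩
    refine Fin.cases ?_ (fun i => ?_) i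
    · simpa [liftSub, maxPriority] using (one_le_maxPriority φ).trans hφ.2
    · simpa [liftSub, maxPriority_rename] using hσ i

/-! ### Traces of formulas -/

/-- The formula `ψ` may follow `φ` in a match. -/
def Succ : Sentence P A → Sentence P A → Prop
  | or φ ψ, χ => χ = φ ∨ χ = ψ
  | and φ ψ, χ => χ = φ ∨ χ = ψ
  | dia _ φ, χ => χ = φ
  | box _ φ, χ => χ = φ
  | mu φ, χ => χ = φ.unfoldMu
  | nu φ, χ => χ = φ.unfoldNu
  | _, _ => False

theorem Succ.maxPriority_le {φ ψ : Sentence P A} (h : Succ φ ψ) :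
    maxPriority ψ ≤ maxPriority φ := by
  cases φ with
  | bot | top | prop | nprop | var => exact h.elim
  | or φ ψ | and φ ψ => rcases h with rfl | rfl <;> simp [maxPriority]
  | dia a φ | box a φ => obtain rfl := h; simp [maxPriority]
  | mu φ | nu φ =>
    obtain rfl := h
    exact maxPriority_subst_le _ _ (by simp [maxPriority]) fun _ => le_rfl

/-- A fixpoint formula that recurs in the sequence and whose priority, and that of its negation,
bounds those of all later members of the sequence. -/
def Dominated (φ : ℕ → Sentence P A) : Prop :=
  ∃ ξ : Sentence P A, (Even (priority ξ) ↔ Odd (priority ξ.neg)) ∧ (∃ᶠ i in atTop, φ i = ξ) ∧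
    ∀ᶠ i in atTop, priority (φ i) ≤ priority ξ ∧ priority (φ i).neg ≤ priority ξ.neg

theorem Dominated.of_shift {φ : ℕ → Sentence P A} (m : ℕ) (h : Dominated fun i => φ (i + m)) :
    Dominated φ := by
  obtain ⟨ξ, h₁, h₂, h₃⟩ := h
  refine ⟨ξ, h₁, ?_, ?_⟩
  · rw [← map_add_atTop_eq_nat m]; exact h₂
  · rw [← map_add_atTop_eq_nat m]; exact h₃

/-- From `φ`, the sequence reaches `σ i` for some free variable `i` of `α`, and the priorities on
the way are bounded by `p i` (for the negated sequence, by `q i`). -/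
def Exits {n : ℕ} (φ : ℕ → Sentence P A) (α : Fm P A n) (σ : Fin n → Sentence P A)
    (p q : Fin n → ℕ) : Prop :=
  ∃ N i, occurs α i = true ∧ φ N = σ i ∧
    ∀ j < N, priority (φ j) ≤ max 1 (p i) ∧ priority (φ j).neg ≤ max 1 (q i)

/-- The common step for `μ` and `ν`, with `p` and `q` the priorities of the fixpoint `ξ` and of its
negation. Either the sequence returns to `ξ` forever without exceeding them, and `ξ` dominates; or
after the last such visit the body is left through a variable other than the bound one, or is itself
dominated. -/
theorem dominated_or_exits_fixpoint {n : ℕ} (α : Fm P A (n + 1)) (σ : Fin n → Sentence P A)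
    (ξ : Sentence P A) (p q : ℕ) (hp : priority ξ = p) (hq : priority ξ.neg = q)
    (hpq : Even p ↔ Odd q) (h₁ : depPriority α 0 ≤ p) (h₂ : depPriority α.neg 0 ≤ q)
    (hξ : ∀ χ, Succ ξ χ → χ = subst (Fin.cases ξ σ) α)
    (ih : ∀ φ : ℕ → Sentence P A, φ 0 = subst (Fin.cases ξ σ) α →
      (∀ i, Succ (φ i) (φ (i + 1))) → Dominated φ ∨
        Exits φ α (Fin.cases ξ σ) (depPriority α) (depPriority α.neg))
    (φ : ℕ → Sentence P A) (h0 : φ 0 = ξ) (hs : ∀ i, Succ (φ i) (φ (i + 1))) :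
    Dominated φ ∨ ∃ N i, occurs α i.succ = true ∧ φ N = σ i ∧
      ∀ j < N, priority (φ j) ≤ max p (depPriority α i.succ) ∧
        priority (φ j).neg ≤ max q (depPriority α.neg i.succ) := by
  have hp1 : 1 ≤ p := hp ▸ one_le_priority ξ
  have hq1 : 1 ≤ q := hq ▸ one_le_priority ξ.neg
  -- Visits to `ξ` before which no priority has exceeded `p` or `q`.
  let Q : ℕ → Prop := fun m => φ m = ξ ∧ ∀ j < m, priority (φ j) ≤ p ∧ priority (φ j).neg ≤ q
  by_cases hQ : ∀ m, Q m → ∃ m' > m, Q m'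
  · left
    have hub : ∀ m, ∃ m' ≥ m, Q m' := by
      intro m
      induction m with
      | zero => exact ⟨0, le_rfl, h0, by simp⟩
      | succ m ih =>
        obtain ⟨m', hm, h⟩ := ih
        obtain ⟨m'', hm', h'⟩ := hQ m' h
        exact ⟨m'', by omega, h'⟩
    refine ⟨ξ, by rw [hp, hq]; exact hpq, ?_, Eventually.of_forall fun i => ?_⟩
    · refine frequently_atTop.2 fun m => ?_
      obtain ⟨m', hm, h⟩ := hub m
      exact ⟨m', hm, h.1⟩
    · obtain ⟨m', hm, h⟩ := hub (i + 1)
      rw [hp, hq]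
      exact h.2 i (by omega)
  · push Not at hQ
    obtain ⟨m, hm, hm'⟩ := hQ
    have hlast : ∀ j, j ≤ m → priority (φ j) ≤ p ∧ priority (φ j).neg ≤ q := by
      intro j hj
      rcases hj.lt_or_eq with hj | rfl
      · exact hm.2 j hj
      · rw [hm.1, hp, hq]; exact ⟨le_rfl, le_rfl⟩
    rcases ih (fun i => φ (i + (m + 1)))
      (by rw [zero_add]; exact hξ _ (hm.1 ▸ hs m))
      (fun i => by have := hs (i + (m + 1)); rwa [add_right_comm] at this) with h | h
    · exact Or.inl (h.of_shift _)
    · obtain ⟨N, i, ho, hN, hb⟩ := h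
      have hb' : ∀ j, m < j → j < N + (m + 1) → priority (φ j) ≤ max 1 (depPriority α i) ∧
          priority (φ j).neg ≤ max 1 (depPriority α.neg i) := by
        intro j hj hj'
        have := hb (j - (m + 1)) (by omega)
        dsimp only at this
        rwa [show j - (m + 1) + (m + 1) = j by omega] at this
      induction i using Fin.cases with
      | zero =>
        -- Leaving the body through the bound variable returns to `ξ` within the bounds, against the
        -- choice of `m` as the last such visit.
        refine absurd ⟨hN, fun j hj => ?_⟩ (hm' (N + (m + 1)) (by omega))
        rcases le_or_gt j m with h | h
        · exact hlast j h
        · have := hb' j h hj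
          omega
      | succ i =>
        refine Or.inr ⟨N + (m + 1), i, ho, hN, fun j hj => ?_⟩
        rcases le_or_gt j m with h | h
        · have := hlast j h
          omega
        · have := hb' j h hj
          omega

theorem occurs_neg {n : ℕ} (φ : Fm P A n) (i : Fin n) : occurs φ.neg i = occurs φ i := by
  induction φ <;> simp_all [neg, occurs]

theorem Exits.of_succ {n : ℕ} {φ : ℕ → Sentence P A} {α β : Fm P A n} {σ : Fin n → Sentence P A}
    {p q p' q' : Fin n → ℕ} (h : Exits (fun i => φ (i + 1)) α σ p q)
    (ho : ∀ i, occurs α i = true → occurs β i = true) (hp : ∀ i, p i ≤ p' i) (hq : ∀ i, q i ≤ q' i)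
    (h1 : priority (φ 0) = 1) (h2 : priority (φ 0).neg = 1) : Exits φ β σ p' q' := by
  obtain ⟨N, i, hi, hN, hb⟩ := h
  refine ⟨N + 1, i, ho i hi, hN, fun j hj => ?_⟩
  cases j with
  | zero => rw [h1, h2]; exact ⟨le_max_left _ _, le_max_left _ _⟩
  | succ j =>
    have h := hb j (by omega)
    exact ⟨h.1.trans (max_le_max_left 1 (hp i)), h.2.trans (max_le_max_left 1 (hq i))⟩

/-- Unfolding does not reduce formula size, so the induction is on the open formula `α` underlying
`φ 0`; the unfolded fixpoints are carried in `σ`. Bounding `φ` and its negation together makes one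
formula `ξ` serve both sides. -/
theorem dominated_or_exits {n : ℕ} (α : Fm P A n) (σ : Fin n → Sentence P A)
    (φ : ℕ → Sentence P A) (h0 : φ 0 = subst σ α) (hs : ∀ i, Succ (φ i) (φ (i + 1))) :
    Dominated φ ∨ Exits φ α σ (depPriority α) (depPriority α.neg) := by
  have h01 := hs 0
  rw [h0] at h01
  induction α generalizing φ with
  | bot | top | prop | nprop => exact h01.elim
  | var i => exact Or.inr ⟨0, i, by simp [occurs], h0, by simp⟩
  | or α β ih₁ ih₂ | and α β ih₁ ih₂ =>
    rcases h01 with h | h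
    · exact (ih₁ σ (fun i => φ (i + 1)) h (fun i => hs _) (h ▸ hs 1)).imp (Dominated.of_shift 1)
        fun h => h.of_succ (by simp +contextual [occurs]) (fun i => le_max_left _ _)
          (fun i => le_max_left _ _) (by rw [h0]; rfl) (by rw [h0]; rfl)
    · exact (ih₂ σ (fun i => φ (i + 1)) h (fun i => hs _) (h ▸ hs 1)).imp (Dominated.of_shift 1)
        fun h => h.of_succ (by simp +contextual [occurs]) (fun i => le_max_right _ _)
          (fun i => le_max_right _ _) (by rw [h0]; rfl) (by rw [h0]; rfl)
  | dia a α ih | box a α ih =>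
    exact (ih σ (fun i => φ (i + 1)) h01 (fun i => hs _) (h01 ▸ hs 1)).imp (Dominated.of_shift 1)
      fun h => h.of_succ (by simp [occurs]) (fun i => le_rfl)
        (fun i => le_rfl) (by rw [h0]; rfl) (by rw [h0]; rfl)
  | mu α ih =>
    rcases dominated_or_exits_fixpoint α σ (subst σ α.mu) (evenAbove (depPriority α 0))
      (oddAbove (depPriority α.neg 0))
      (by simp [subst, priority, depPriority_subst_liftSub])
      (by simp [neg_subst, neg, subst, priority, ← neg_liftSub, depPriority_subst_liftSub])
      (iff_of_true (even_evenAbove _) (odd_oddAbove _)) (le_evenAbove _) (le_oddAbove _)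
      (by rintro χ rfl; exact subst_liftSub α σ _)
      (fun ψ h hs => ih _ ψ h hs (h ▸ hs 0)) φ h0 hs with h | ⟨N, i, ho, hN, hb⟩
    · exact Or.inl h
    · refine Or.inr ⟨N, i, ho, hN, fun j hj => ?_⟩
      have := hb j hj
      -- The recorded occurrence of the exit variable selects the branch of `depPriority` that
      -- counts the present fixpoint.
      simp only [depPriority, neg, ho, occurs_neg, if_true]
      omega
  | nu α ih =>
    rcases dominated_or_exits_fixpoint α σ (subst σ α.nu) (oddAbove (depPriority α 0))
      (evenAbove (depPriority α.neg 0))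
      (by simp [subst, priority, depPriority_subst_liftSub])
      (by simp [neg_subst, neg, subst, priority, ← neg_liftSub, depPriority_subst_liftSub])
      (iff_of_false (Nat.not_even_iff_odd.2 (odd_oddAbove _))
        (Nat.not_odd_iff_even.2 (even_evenAbove _))) (le_oddAbove _) (le_evenAbove _)
      (by rintro χ rfl; exact subst_liftSub α σ _)
      (fun ψ h hs => ih _ ψ h hs (h ▸ hs 0)) φ h0 hs with h | ⟨N, i, ho, hN, hb⟩
    · exact Or.inl h
    · refine Or.inr ⟨N, i, ho, hN, fun j hj => ?_⟩
      have := hb j hj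
      simp only [depPriority, neg, ho, occurs_neg, if_true]
      omega

theorem dominated_of_succ (φ : ℕ → Sentence P A) (hs : ∀ i, Succ (φ i) (φ (i + 1))) :
    Dominated φ := by
  rcases dominated_or_exits (φ 0) var φ (subst_var _).symm hs with h | ⟨_, i, _⟩
  · exact h
  · exact i.elim0

end Fm

theorem LimMax.unique {k : ℕ → ℕ} {K L : ℕ} (h : LimMax k K) (h' : LimMax k L) : K = L := by
  obtain ⟨i, rfl, hi⟩ := (h.1.and_eventually h'.2).exists
  obtain ⟨j, rfl, hj⟩ := (h'.1.and_eventually h.2).exists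
  omega

/-- An infinite sequence of formulas and the sequence of their negations are won by opposite
players. -/
theorem exists_limMax_neg (φ : ℕ → Sentence P A) (hs : ∀ i, Fm.Succ (φ i) (φ (i + 1))) :
    ∃ K L, LimMax (fun i => (φ i).priority) K ∧ LimMax (fun i => (φ i).neg.priority) L ∧
      (Even K ↔ Odd L) := by
  obtain ⟨ξ, h₁, h₂, h₃⟩ := Fm.dominated_of_succ φ hs
  exact ⟨_, _, ⟨h₂.mono fun i hi => congrArg _ hi, h₃.mono fun i hi => hi.1⟩,
    ⟨h₂.mono fun i hi => congrArg (fun χ => (Fm.neg χ).priority) hi, h₃.mono fun i hi => hi.2⟩, h₁⟩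


/-! ### Positional determinacy of parity games -/

theorem LimMax.of_shift {k : ℕ → ℕ} {K : ℕ} (m : ℕ) (h : LimMax (fun i => k (i + m)) K) :
    LimMax k K := by
  refine ⟨?_, ?_⟩
  · rw [← map_add_atTop_eq_nat m]; exact h.1
  · rw [← map_add_atTop_eq_nat m]; exact h.2

theorem LimMax.shift {k : ℕ → ℕ} {K : ℕ} (m : ℕ) (h : LimMax k K) :
    LimMax (fun i => k (i + m)) K := by
  unfold LimMax at h
  rw [← map_add_atTop_eq_nat m] at h
  exact h

namespace ParityGame

variable {V : Type w} (E : V → V → Prop) (own : Set V) (p : V → ℕ) (good : ℕ → Prop)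

/-- The winning region of the owner of `own` in the parity game on the graph `E` with priority
function `p` in which moves from positions of priority `k ≥ n` end the game and are won if they
lead to `Y k`; infinite matches are won if the maximal recurring priority is `good`. -/
def winSet : ℕ → (ℕ → Set V) → Set V
  | 0, Y => {v | (v ∈ own ∧ ∃ v', E v v' ∧ v' ∈ Y (p v)) ∨ (v ∉ own ∧ ∀ v', E v v' → v' ∈ Y (p v))}
  | n + 1, Y =>
    {v | (good n ∧ ∃ X, X ⊆ winSet n (Function.update Y n X) ∧ v ∈ X) ∨
      (¬ good n ∧ ∀ X, winSet n (Function.update Y n X) ⊆ X → v ∈ X)}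

theorem update_mono {Y Y' : ℕ → Set V} {n : ℕ} {X X' : Set V} (hY : Y ≤ Y') (hX : X ≤ X') :
    Function.update Y n X ≤ Function.update Y' n X' :=
  update_le_update_iff.2 ⟨hX, fun j _ => hY j⟩

/-- Monotonicity turns the explicit union and intersection in `winSet` into a greatest and a least
fixpoint. -/
theorem winSet_mono (n : ℕ) : Monotone (winSet E own p good n) := by
  induction n with
  | zero =>
    intro Y Y' h v
    rintro (⟨h₁, v', h₂, h₃⟩ | ⟨h₁, h₂⟩)
    · exact Or.inl ⟨h₁, v', h₂, h _ h₃⟩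
    · exact Or.inr ⟨h₁, fun v' h' => h _ (h₂ v' h')⟩
  | succ n ih =>
    intro Y Y' h v
    rintro (⟨h₁, X, h₂, h₃⟩ | ⟨h₁, h₂⟩)
    · exact Or.inl ⟨h₁, X, h₂.trans (ih (update_mono h le_rfl)), h₃⟩
    · exact Or.inr ⟨h₁, fun X hX => h₂ X ((ih (update_mono h le_rfl)).trans hX)⟩

/-- The operator whose least or greatest fixpoint is `winSet (n + 1) Y`. -/
def winStep (n : ℕ) (Y : ℕ → Set V) : Set V →o Set V where
  toFun X := winSet E own p good n (Function.update Y n X)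
  monotone' _ _ h := winSet_mono E own p good n (update_mono le_rfl h)

theorem winSet_succ_of_good {n : ℕ} (h : good n) (Y : ℕ → Set V) :
    winSet E own p good (n + 1) Y = (winStep E own p good n Y).gfp := by
  ext v
  simp only [winSet, h, true_and, not_true, false_and, or_false, Set.mem_ofPred_eq]
  constructor
  · rintro ⟨X, h, hv⟩
    exact (winStep E own p good n Y).le_gfp h hv
  · exact fun hv => ⟨_, (winStep E own p good n Y).map_gfp.ge, hv⟩

theorem winSet_succ_of_not_good {n : ℕ} (h : ¬ good n) (Y : ℕ → Set V) :
    winSet E own p good (n + 1) Y = (winStep E own p good n Y).lfp := by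
  ext v
  simp only [winSet, h, not_false_iff, true_and, false_and, false_or, Set.mem_ofPred_eq]
  constructor
  · exact fun hv => hv _ (winStep E own p good n Y).map_lfp.le
  · exact fun hv X h => (winStep E own p good n Y).lfp_le h hv

theorem update_compl (Y : ℕ → Set V) (n : ℕ) (X : Set V) :
    Function.update (fun k => (Y k)ᶜ) n Xᶜ = fun k => (Function.update Y n X k)ᶜ := by
  funext k
  by_cases h : k = n
  · subst h; simp
  · simp [h]

/-- The complement of a winning region is the winning region of the other player. -/
theorem winSet_compl (n : ℕ) (Y : ℕ → Set V) :
    winSet E ownᶜ p (fun k => ¬ good k) n (fun k => (Y k)ᶜ) = (winSet E own p good n Y)ᶜ := by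
  induction n generalizing Y with
  | zero =>
    ext v
    by_cases h : v ∈ own <;> simp [winSet, h]
  | succ n ih =>
    have ih' (X : Set V) : winSet E ownᶜ p (fun k => ¬ good k) n
        (Function.update (fun k => (Y k)ᶜ) n X) =
          (winSet E own p good n (Function.update Y n Xᶜ))ᶜ := by
      rw [← ih, ← update_compl, compl_compl]
    ext v
    by_cases h : good n <;>
      simp only [winSet, ih', h, true_and, not_true, not_false_iff, false_and, or_false, false_or,
        Set.mem_ofPred_eq, Set.mem_compl_iff, not_exists, not_and, not_forall]
    · constructor
      · intro hv X hX
        simpa using hv Xᶜ (by rw [compl_compl]; exact Set.compl_subset_compl.2 hX)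
      · intro hv X hX
        by_contra hv'
        exact hv Xᶜ (by rwa [Set.compl_subset_comm] at hX) hv'
    · constructor
      · rintro ⟨X, hX, hv⟩
        exact ⟨Xᶜ, by rwa [Set.subset_compl_comm] at hX, by simpa using hv⟩
      · rintro ⟨X, hX, hv⟩
        exact ⟨Xᶜ, by rw [compl_compl]; exact Set.compl_subset_compl.2 hX, hv⟩

/-- The positional strategy `c` keeps to the set given by `T` when it moves from `v`. -/
def StaysIn (c : V → V) (T : Set V) (v : V) : Prop :=
  (v ∈ own → E v (c v) ∧ c v ∈ T) ∧ (v ∉ own → ∀ v', E v v' → v' ∈ T)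

/-- `π` is an infinite match guided by `c`. -/
def IsMatch (c : V → V) (π : ℕ → V) : Prop :=
  ∀ i, E (π i) (π (i + 1)) ∧ (π i ∈ own → π (i + 1) = c (π i))

theorem exists_limMax_of_shift {π : ℕ → V} (m : ℕ)
    (h : ∃ K, good K ∧ LimMax (fun i => p (π (i + m))) K) :
    ∃ K, good K ∧ LimMax (fun i => p (π i)) K := by
  obtain ⟨K, h, h'⟩ := h
  exact ⟨K, h, h'.of_shift (k := fun i => p (π i))⟩

/-- Induction on the number of priorities still in play. For a good top priority, a strategy that
stays in the greatest fixpoint suffices: either that priority recurs, or it eventually stops and the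
induction hypothesis applies. For a bad one, the strategies for the ordinal stages of the least
fixpoint are glued by rank: the rank never rises and drops at each visit to the top priority, so
such visits cease. -/
theorem exists_strategy (n : ℕ) (Y : ℕ → Set V) : ∃ c : V → V,
    (∀ v ∈ winSet E own p good n Y,
      (p v < n → StaysIn E own c (winSet E own p good n Y) v) ∧
      (n ≤ p v → StaysIn E own c (Y (p v)) v)) ∧
    ∀ π, IsMatch E own c π → (∀ i, π i ∈ winSet E own p good n Y) → (∀ i, p (π i) < n) →
      ∃ K, good K ∧ LimMax (fun i => p (π i)) K := by
  classical
  induction n generalizing Y with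
  | zero =>
    refine ⟨fun v => if h : ∃ v', E v v' ∧ v' ∈ Y (p v) then h.choose else v,
      fun v hv => ⟨fun h => absurd h (by simp), fun _ => ?_⟩, fun π _ _ h => absurd (h 0) (by simp)⟩
    rcases hv with ⟨h₁, h₂⟩ | ⟨h₁, h₂⟩
    · exact ⟨fun _ => by simp only [dif_pos h₂]; exact h₂.choose_spec, fun h => absurd h₁ h⟩
    · exact ⟨fun h => absurd h h₁, fun _ => h₂⟩
  | succ n ih =>
    by_cases hn : good n
    · rw [winSet_succ_of_good E own p good hn]
      set f := winStep E own p good n Y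
      have hf : winSet E own p good n (Function.update Y n f.gfp) = f.gfp := f.map_gfp
      obtain ⟨c, hc₁, hc₂⟩ := ih (Function.update Y n f.gfp)
      rw [hf] at hc₁ hc₂
      refine ⟨c, fun v hv => ⟨fun h => ?_, fun h => ?_⟩, fun π h₁ h₂ h₃ => ?_⟩
      · rcases (Nat.lt_succ_iff.1 h).lt_or_eq with h | h
        · exact (hc₁ v hv).1 h
        · simpa [h] using (hc₁ v hv).2 h.ge
      · simpa [show p v ≠ n by omega] using (hc₁ v hv).2 (by omega)
      · by_cases hfr : ∃ᶠ i in atTop, p (π i) = n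
        · exact ⟨n, hn, hfr, Eventually.of_forall fun i => Nat.lt_succ_iff.1 (h₃ i)⟩
        · obtain ⟨m, hm⟩ := eventually_atTop.1 (not_frequently.1 hfr)
          refine exists_limMax_of_shift p good m (hc₂ (fun i => π (i + m)) (fun i => ?_)
            (fun i => h₂ _) fun i => ?_)
          · have := h₁ (i + m); rwa [add_right_comm] at this
          · have := hm (i + m) (by omega); have := h₃ (i + m); omega
    · rw [winSet_succ_of_not_good E own p good hn]
      set f := winStep E own p good n Y
      let S : Ordinal.{w} → Set V := OrdinalApprox.lfpApprox f ⊥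
      have hS_mem {β v} : v ∈ S β ↔ ∃ γ < β, v ∈ f (S γ) := by
        change v ∈ OrdinalApprox.lfpApprox f ⊥ β ↔ _
        rw [OrdinalApprox.lfpApprox]
        simp [S]
      have hS_le (β) : S β ⊆ f.lfp := OrdinalApprox.lfpApprox_le_of_mem_fixedPoints f
        f.map_lfp bot_le β
      obtain ⟨β₀, hβ₀⟩ := OrdinalApprox.lfp_mem_range_lfpApprox f
      have hex {v} (hv : v ∈ f.lfp) : ∃ β, v ∈ f (S β) := by
        rw [← hβ₀] at hv
        obtain ⟨γ, -, h⟩ := hS_mem.1 hv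
        exact ⟨γ, h⟩
      have hfle (β) : f (S β) ⊆ f.lfp := (f.mono (hS_le β)).trans f.map_lfp.le
      -- The rank is the least stage after which `v` enters. The glued strategy uses at `v` the
      -- strategy for that stage, and so remains positional.
      let r : V → Ordinal.{w} := fun v => sInf {β | v ∈ f (S β)}
      have hr {v} (hv : v ∈ f.lfp) : v ∈ f (S (r v)) := csInf_mem (s := {β | v ∈ f (S β)}) (hex hv)
      have hr_le {v β} (hv : v ∈ f (S β)) : r v ≤ β := csInf_le' hv
      choose c hc₁ hc₂ using fun β => ih (Function.update Y n (S β))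
      change ∀ β, ∀ v ∈ f (S β), (p v < n → StaysIn E own (c β) (f (S β)) v) ∧ _ at hc₁
      change ∀ β π, IsMatch E own (c β) π → (∀ i, π i ∈ f (S β)) → _ at hc₂
      have hstay {v T T'} (h : StaysIn E own (c (r v)) T v) (hT : T ⊆ T') :
          StaysIn E own (fun v => c (r v) v) T' v :=
        ⟨fun ho => ⟨(h.1 ho).1, hT (h.1 ho).2⟩, fun ho v' h' => hT (h.2 ho v' h')⟩
      have heq {v} (hv : v ∈ f.lfp) (h : p v = n) :
          StaysIn E own (fun v => c (r v) v) (S (r v)) v :=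
        hstay (by simpa [h] using (hc₁ _ v (hr hv)).2 h.ge) subset_rfl
      have hlt {v} (hv : v ∈ f.lfp) (h : p v < n) :
          StaysIn E own (fun v => c (r v) v) (f (S (r v))) v :=
        hstay ((hc₁ _ v (hr hv)).1 h) subset_rfl
      have hstep {v v' T} (h : StaysIn E own (fun v => c (r v) v) T v) (hE : E v v')
          (ho : v ∈ own → v' = c (r v) v) : v' ∈ T := by
        by_cases h' : v ∈ own
        · rw [ho h']; exact (h.1 h').2
        · exact h.2 h' v' hE
      refine ⟨fun v => c (r v) v, fun v hv => ⟨fun h => ?_, fun h => ?_⟩, fun π h₁ h₂ h₃ => ?_⟩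
      · rcases (Nat.lt_succ_iff.1 h).lt_or_eq with h | h
        · exact hstay (hlt hv h) (hfle _)
        · exact hstay (heq hv h) (hS_le _)
      · exact hstay (by simpa [show p v ≠ n by omega] using (hc₁ _ v (hr hv)).2 (by omega))
          subset_rfl
      · have hdec (i) : r (π (i + 1)) ≤ r (π i) ∧ (p (π i) = n → r (π (i + 1)) < r (π i)) := by
          have hlt' (h : p (π i) = n) : r (π (i + 1)) < r (π i) := by
            obtain ⟨γ, hγ, h⟩ := hS_mem.1 (hstep (heq (h₂ i) h) (h₁ i).1 (h₁ i).2)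
            exact (hr_le h).trans_lt hγ
          refine ⟨?_, hlt'⟩
          rcases (Nat.lt_succ_iff.1 (h₃ i)).lt_or_eq with h | h
          · exact hr_le (hstep (hlt (h₂ i) h) (h₁ i).1 (h₁ i).2)
          · exact (hlt' h).le
        have hanti : Antitone fun i => r (π i) := antitone_nat_of_succ_le fun i => (hdec i).1
        obtain ⟨m, hm⟩ := WellFoundedLT.antitone_chain_condition hanti
        have hconst (i) (hi : m ≤ i) : r (π i) = r (π m) := (hm i hi).symm
        -- Once the rank is constant, the glued strategy coincides along the match with the strategy
        -- of a single stage.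
        refine exists_limMax_of_shift p good m (hc₂ (r (π m)) (fun i => π (i + m)) (fun i => ?_)
          (fun i => ?_) fun i => ?_)
        · have := h₁ (i + m)
          rw [add_right_comm] at this
          rw [← hconst (i + m) (by omega)]
          exact this
        · rw [← hconst (i + m) (by omega)]
          exact hr (h₂ _)
        · refine (Nat.lt_succ_iff.1 (h₃ (i + m))).lt_of_ne fun h => ?_
          have := (hdec (i + m)).2 h
          rw [hconst (i + m) (by omega), hconst (i + m + 1) (by omega)] at this
          exact this.false

/-- Positional determinacy: the positions of a parity game with bounded priorities split into two
regions which the two players win by positional strategies. -/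
theorem positional_determinacy (n : ℕ) (hp : ∀ v, p v < n) :
    ∃ (W : Set V) (c c' : V → V),
      (∀ v ∈ W, StaysIn E own c W v) ∧ (∀ v ∉ W, StaysIn E ownᶜ c' Wᶜ v) ∧
      (∀ π, IsMatch E own c π → (∀ i, π i ∈ W) → ∃ K, good K ∧ LimMax (fun i => p (π i)) K) ∧
      (∀ π, IsMatch E ownᶜ c' π → (∀ i, π i ∉ W) →
        ∃ K, ¬ good K ∧ LimMax (fun i => p (π i)) K) := by
  obtain ⟨c, hc₁, hc₂⟩ := exists_strategy E own p good n fun _ => ∅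
  obtain ⟨c', hc₁', hc₂'⟩ := exists_strategy E ownᶜ p (fun k => ¬ good k) n fun _ => ∅ᶜ
  rw [winSet_compl E own p good n fun _ => ∅] at hc₁' hc₂'
  exact ⟨winSet E own p good n fun _ => ∅, c, c', fun v hv => (hc₁ v hv).1 (hp v),
    fun v hv => (hc₁' v hv).1 (hp v), fun π h h' => hc₂ π h h' fun i => hp _,
    fun π h h' => hc₂' π h h' fun i => hp _⟩

end ParityGame


/-! ### The evaluation game -/

section Game

variable [ConverseActions A] {M : Model.{u, v, w} P A}

theorem Move.succ {v v' : Pos M} (h : Move M v v') : Fm.Succ v.1 v'.1 := by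
  cases h <;> simp [Fm.Succ]

/-- The position of the negated formula. -/
def negPos (v : Pos M) : Pos M := (v.1.neg, v.2)

theorem negPos_negPos (v : Pos M) : negPos (negPos v) = v := by simp [negPos, Fm.neg_neg]

theorem Move.negPos {v v' : Pos M} (h : Move M v v') : Move M (negPos v) (negPos v') := by
  cases h with
  | or_left => exact .and_left _ _ _
  | or_right => exact .and_right _ _ _
  | and_left => exact .or_left _ _ _
  | and_right => exact .or_right _ _ _
  | dia _ h => exact .box _ h
  | box _ h => exact .dia _ h
  | mu φ s =>
    unfold TwoWayMu.negPos
    rw [Fm.neg_unfoldMu]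
    exact .nu _ _
  | nu φ s =>
    unfold TwoWayMu.negPos
    rw [Fm.neg_unfoldNu]
    exact .mu _ _

theorem EloiseOwns.not_negPos {v : Pos M} (h : EloiseOwns M v) : ¬ EloiseOwns M (negPos v) := by
  obtain ⟨φ, s⟩ := v
  cases φ <;> simp_all [EloiseOwns, negPos, Fm.neg]

/-- A position that neither player owns together with its negation has exactly one move. -/
theorem existsUnique_move {v : Pos M} (h : ¬ EloiseOwns M v) (h' : ¬ EloiseOwns M (negPos v)) :
    ∃! v', Move M v v' := by
  obtain ⟨φ, s⟩ := v
  cases φ <;> simp_all [EloiseOwns, negPos, Fm.neg]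
  case var i => exact i.elim0
  case mu φ => exact ⟨_, .mu φ s, fun v' h => by cases h; rfl⟩
  case nu φ => exact ⟨_, .nu φ s, fun v' h => by cases h; rfl⟩

/-! ### Positional strategies and winning positions. -/

namespace Strategy

/-- A move that is compatible with the positional strategy `f`. -/
def Step (f : Strategy M) (v v' : Pos M) : Prop :=
  Move M v v' ∧ (EloiseOwns M v → v' = f.move [] v)

variable {f : Strategy M}

theorem Positional.guides_iff (hf : f.Positional) (π : ℕ → Pos M) (n : ℕ) :
    f.Guides π n ↔ ∀ i < n, f.Step (π i) (π (i + 1)) := by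
  simp only [Guides, Step, hf _ [] _]

theorem Positional.forall_guides_iff (hf : f.Positional) (π : ℕ → Pos M) :
    (∀ n, f.Guides π n) ↔ ∀ i, f.Step (π i) (π (i + 1)) := by
  simp only [hf.guides_iff]
  exact ⟨fun h i => h (i + 1) i (by omega), fun h n i _ => h i⟩

theorem WinsFrom.exists_move {v : Pos M} (h : f.WinsFrom v) (ho : EloiseOwns M v) :
    ∃ v', Move M v v' := by
  by_contra h'
  exact h.1 (fun _ => v) 0 rfl (by simp [Guides]) h' ho

theorem step_move {v : Pos M} (ho : EloiseOwns M v) (h : ∃ v', Move M v v') :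
    f.Step v (f.move [] v) := ⟨f.legal _ _ ho h, fun _ => rfl⟩

/-- A positional strategy that wins in the sense of all its successors wins. -/
theorem winsFrom_of_forall_step {g : Strategy M} {v : Pos M} (hg : g.Positional)
    (W : Set (Pos M)) (hv : v ∈ W) (hstuck : ∀ v ∈ W, EloiseOwns M v → ∃ v', Move M v v')
    (hW : ∀ v ∈ W, ∀ v', g.Step v v' → v' ∈ W)
    (hinf : ∀ π : ℕ → Pos M, π 0 = v → (∀ i, π i ∈ W) → (∀ i, g.Step (π i) (π (i + 1))) →
      ∃ K, Odd K ∧ LimMax (fun i => (π i).1.priority) K) : g.WinsFrom v := by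
  have hmem (π : ℕ → Pos M) (n : ℕ) (h0 : π 0 = v) (h : ∀ i < n, g.Step (π i) (π (i + 1))) :
      ∀ i ≤ n, π i ∈ W := by
    intro i
    induction i with
    | zero => exact fun _ => h0 ▸ hv
    | succ i ih => exact fun hi => hW _ (ih (by omega)) _ (h i (by omega))
  refine ⟨fun π n h0 h hn ho => hn (hstuck _ ?_ ho), fun π h0 h => ?_⟩
  · exact hmem π n h0 ((hg.guides_iff π n).1 h) n le_rfl
  · have h := (hg.forall_guides_iff π).1 h
    exact hinf π h0 (fun i => hmem π i h0 (fun j _ => h j) i le_rfl) h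

theorem exists_positional (c : Pos M → Pos M) : ∃ g : Strategy M, g.Positional ∧
    ∀ v, Move M v (c v) → g.move [] v = c v := by
  classical
  refine ⟨⟨fun _ v => if Move M v (c v) then c v else
    if h : ∃ v', Move M v v' then h.choose else v, fun _ v _ hv => ?_⟩, fun _ _ _ => rfl,
    fun v hv => if_pos hv⟩
  by_cases h : Move M v (c v)
  · simp [h]
  · simpa only [h, if_false, dif_pos hv] using hv.choose_spec

/-- A winning strategy that starts with the move `v → v'` and continues with `f`. -/
theorem Positional.exists_winsFrom_of_move (hf : f.Positional) {v v' : Pos M}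
    (ho : EloiseOwns M v) (hm : Move M v v') (h : f.WinsFrom v') :
    ∃ g : Strategy M, g.WinsFrom v := by
  classical
  -- Only the opening move is changed, which the empty history detects: a positional change at `v`
  -- would also alter later visits to `v`.
  let g : Strategy M :=
    { move := fun l x => if l = [] ∧ x = v then v' else f.move l x
      legal := fun l x hx h => by
        by_cases hl : l = [] ∧ x = v
        · simpa [hl] using hm
        · simpa only [hl, if_false] using f.legal l x hx h }
  have key (π : ℕ → Pos M) (n : ℕ) (h0 : π 0 = v) (h : g.Guides π (n + 1)) :
      π 1 = v' ∧ f.Guides (fun i => π (i + 1)) n := by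
    refine ⟨?_, (hf.guides_iff _ _).2 fun i hi => ⟨(h (i + 1) (by omega)).1, fun ho => ?_⟩⟩
    · have := (h 0 (by omega)).2 (h0 ▸ ho)
      simpa [g, h0] using this
    · have := (h (i + 1) (by omega)).2 ho
      rw [hf [] ((List.range (i + 1)).map π)]
      simpa [g] using this
  refine ⟨g, fun π n h0 hg hn => ?_, fun π h0 hg => ?_⟩
  · cases n with
    | zero => exact absurd ⟨v', h0 ▸ hm⟩ hn
    | succ n =>
      have := key π n h0 hg
      exact h.1 (fun i => π (i + 1)) n this.1 this.2 hn
  · obtain ⟨K, hK, hl⟩ := h.2 (fun i => π (i + 1)) (key π 0 h0 (hg 1)).1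
      fun n => (key π n h0 (hg (n + 1))).2
    exact ⟨K, hK, LimMax.of_shift (k := fun i => (π i).1.priority) 1 hl⟩

theorem WinsFrom.of_step (hf : f.Positional) {v v' : Pos M} (h : f.WinsFrom v)
    (hs : f.Step v v') : f.WinsFrom v' := by
  let cons (π : ℕ → Pos M) : ℕ → Pos M := fun i => Nat.casesOn i v π
  have hcons (π : ℕ → Pos M) (n : ℕ) (h0 : π 0 = v') (hg : f.Guides π n) :
      f.Guides (cons π) (n + 1) := by
    refine (hf.guides_iff _ _).2 fun i hi => ?_
    cases i with
    | zero => change f.Step v (π 0); rwa [h0]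
    | succ i => exact (hf.guides_iff _ _).1 hg i (by omega)
  refine ⟨fun π n h0 hg hn => h.1 (cons π) (n + 1) rfl (hcons π n h0 hg) hn, fun π h0 hg => ?_⟩
  obtain ⟨K, hK, hl⟩ := h.2 (cons π) rfl fun n => by
    cases n with
    | zero => simp [Guides]
    | succ n => exact hcons π n h0 (hg n)
  exact ⟨K, hK, hl.shift 1⟩

/-- No strategy wins from a formula and its negation. -/
theorem WinsFrom.not_negPos (hf : f.Positional) {v : Pos M} (h : f.WinsFrom v) :
    ¬ f.WinsFrom (negPos v) := by
  intro h'
  have hnext (v : {v : Pos M // f.WinsFrom v ∧ f.WinsFrom (negPos v)}) :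
      ∃ v' : {v : Pos M // f.WinsFrom v ∧ f.WinsFrom (negPos v)},
        f.Step v v' ∧ f.Step (negPos v) (negPos v') := by
    obtain ⟨v, hv, hv'⟩ := v
    -- Two mirrored matches are played: at each round `f` chooses in at most one of them, and the
    -- other copies the move.
    suffices ∃ v', f.Step v v' ∧ f.Step (negPos v) (negPos v') by
      obtain ⟨v', h₁, h₂⟩ := this
      exact ⟨⟨v', hv.of_step hf h₁, hv'.of_step hf h₂⟩, h₁, h₂⟩
    by_cases ho : EloiseOwns M v
    · have hs := f.step_move ho (hv.exists_move ho)
      exact ⟨_, hs, hs.1.negPos, fun h => absurd h ho.not_negPos⟩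
    · by_cases ho' : EloiseOwns M (negPos v)
      · have hs := f.step_move ho' (hv'.exists_move ho')
        refine ⟨negPos (f.move [] (negPos v)), ⟨?_, fun h => absurd h ho⟩, ?_⟩
        · simpa [negPos_negPos] using hs.1.negPos
        · rwa [negPos_negPos]
      · obtain ⟨v', hm, -⟩ := existsUnique_move ho ho'
        exact ⟨v', ⟨hm, fun h => absurd h ho⟩, hm.negPos, fun h => absurd h ho'⟩
  choose next hnext₁ hnext₂ using hnext
  let π : ℕ → {v : Pos M // f.WinsFrom v ∧ f.WinsFrom (negPos v)} := fun i => next^[i] ⟨v, h, h'⟩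
  have hπ (i) : π (i + 1) = next (π i) := Function.iterate_succ_apply' _ _ _
  have h₁ (i) : f.Step (π i) (π (i + 1)) := by rw [hπ]; exact hnext₁ _
  have h₂ (i) : f.Step (negPos (π i)) (negPos (π (i + 1))) := by rw [hπ]; exact hnext₂ _
  obtain ⟨K, hK, hl⟩ := h.2 (fun i => π i) rfl ((hf.forall_guides_iff _).2 h₁)
  obtain ⟨L, hL, hl'⟩ := h'.2 (fun i => negPos (π i)) rfl ((hf.forall_guides_iff _).2 h₂)
  obtain ⟨K', L', hK', hL', hKL⟩ := exists_limMax_neg (fun i => (π i).1.1) fun i => (h₁ i).1.succ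
  obtain rfl := hl.unique hK'
  obtain rfl := hl'.unique hL'
  exact Nat.not_even_iff_odd.2 hK (hKL.2 hL)

end Strategy

/-- Determinacy of the evaluation game. -/
theorem exists_winsFrom_or_neg (v : Pos M) :
    (∃ g : Strategy M, g.WinsFrom v) ∨ ∃ g : Strategy M, g.WinsFrom (negPos v) := by
  let D := v.1.maxPriority
  -- Priorities are unbounded over all formulas, hence the cap `D`. It is inactive on matches from
  -- `v`, by `hbound`.
  obtain ⟨W, c, c', hc, hc', hπ, hπ'⟩ := ParityGame.positional_determinacy (Move M)
    {v | EloiseOwns M v} (fun v => min v.1.priority D) (fun k => Odd k) (D + 1)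
    fun v => by simp
  have hbound (π : ℕ → Pos M) (h0 : π 0 = v) (h : ∀ i, Move M (π i) (π (i + 1))) (i : ℕ) :
      min (π i).1.priority D = (π i).1.priority := by
    refine min_eq_left ((Fm.priority_le_maxPriority _).trans ?_)
    induction i with
    | zero => rw [h0]
    | succ i ih => exact (h i).succ.maxPriority_le.trans ih
  by_cases hv : v ∈ W
  · left
    obtain ⟨g, hg, hgc⟩ := Strategy.exists_positional c
    have hown {x} (hx : x ∈ W) (ho : EloiseOwns M x) : g.move [] x = c x :=
      hgc x ((hc x hx).1 ho).1
    refine ⟨g, Strategy.winsFrom_of_forall_step hg W hv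
      (fun x hx ho => ⟨_, ((hc x hx).1 ho).1⟩) (fun x hx x' hs => ?_) fun π h0 hW hs => ?_⟩
    · by_cases ho : EloiseOwns M x
      · rw [hs.2 ho, hown hx ho]; exact ((hc x hx).1 ho).2
      · exact (hc x hx).2 ho x' hs.1
    · simpa only [hbound π h0 fun i => (hs i).1] using
        hπ π (fun i => ⟨(hs i).1, fun ho => ((hs i).2 ho).trans (hown (hW i) ho)⟩) hW
  · right
    obtain ⟨g, hg, hgc⟩ := Strategy.exists_positional fun x => negPos (c' (negPos x))
    have hmove {x} (hx : negPos x ∉ W) (ho : ¬ EloiseOwns M (negPos x)) :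
        Move M x (negPos (c' (negPos x))) := by
      simpa only [negPos_negPos] using ((hc' _ hx).1 ho).1.negPos
    have hstep {x x'} (hx : negPos x ∉ W) (hs : g.Step x x') (ho : ¬ EloiseOwns M (negPos x)) :
        negPos x' = c' (negPos x) := by
      rw [← negPos_negPos (c' (negPos x))]
      congr 1
      -- The strategy `c'` also moves at fixpoint positions, where `g` has no say; there the move is
      -- unique, so the two agree.
      by_cases ho' : EloiseOwns M x
      · rw [hs.2 ho', hgc x (hmove hx ho)]
      · exact (existsUnique_move ho' ho).unique hs.1 (hmove hx ho)
    refine ⟨g, Strategy.winsFrom_of_forall_step hg {x | negPos x ∉ W}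
      (by simpa [negPos_negPos] using hv)
      (fun x hx ho => ⟨_, hmove hx ho.not_negPos⟩) (fun x hx x' hs => ?_) fun π h0 hW hs => ?_⟩
    · by_cases ho : EloiseOwns M (negPos x)
      · exact (hc' _ hx).2 (by simpa using ho) _ hs.1.negPos
      · change negPos x' ∉ W
        rw [hstep hx hs ho]
        exact ((hc' _ hx).1 ho).2
    · obtain ⟨K, hK, hl⟩ := hπ' (fun i => negPos (π i))
        (fun i => ⟨(hs i).1.negPos, fun ho => hstep (hW i) (hs i) ho⟩) hW
      simp only [hbound (fun i => negPos (π i)) (by rw [h0, negPos_negPos])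
        fun i => (hs i).1.negPos] at hl
      obtain ⟨K', L', hK', hL', hKL⟩ := exists_limMax_neg (fun i => (π i).1) fun i => (hs i).1.succ
      obtain rfl := hl.unique hL'
      exact ⟨K', Nat.not_even_iff_odd.1 (hKL.not.2 hK), hK'⟩

end Game


/-! ### Soundness of `NW²` -/

/-- Infinite concatenation of finite paths, some of which may be empty. -/
theorem exists_concat {V : Type*} (R : V → V → Prop) (n : ℕ → ℕ) (seg : ℕ → ℕ → V)
    (hseg : ∀ i, seg i (n i) = seg (i + 1) 0)
    (hR : ∀ i, ∀ j < n i, R (seg i j) (seg i (j + 1))) (hn : ∃ᶠ i in atTop, 0 < n i) :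
    ∃ (π : ℕ → V) (N : ℕ → ℕ), π 0 = seg 0 0 ∧ (∀ m, R (π m) (π (m + 1))) ∧ Monotone N ∧
      (∀ i, N (i + 1) = N i + n i) ∧ (∀ i, ∀ j < n i, π (N i + j) = seg i j) ∧
      ∀ m, ∃ i, ∃ j < n i, m = N i + j := by
  classical
  let N : ℕ → ℕ := fun i => ∑ j ∈ Finset.range i, n j
  have hN (i) : N (i + 1) = N i + n i := Finset.sum_range_succ _ _
  have hmono : Monotone N := monotone_nat_of_le_succ fun i => by rw [hN]; omega
  have hex (m : ℕ) : ∃ i, m < N i := by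
    induction m with
    | zero =>
      obtain ⟨i, -, hi⟩ := frequently_atTop.1 hn 0
      exact ⟨i + 1, by rw [hN]; omega⟩
    | succ m ih =>
      obtain ⟨i, hi⟩ := ih
      obtain ⟨i', hi', h⟩ := frequently_atTop.1 hn i
      have := hmono hi'
      exact ⟨i' + 1, by rw [hN]; omega⟩
  have hex' (m : ℕ) : ∃ i, m < N (i + 1) :=
    let ⟨i, hi⟩ := hex m
    ⟨i, hi.trans_le (hmono (by omega))⟩
  let idx : ℕ → ℕ := fun m => Nat.find (hex' m)
  have hidx (m) : m < N (idx m + 1) := Nat.find_spec (hex' m)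
  have hidx' (m) : N (idx m) ≤ m := by
    rcases h : idx m with _ | i
    · exact Nat.zero_le _
    · exact not_lt.1 (Nat.find_min (hex' m) (m := i) (by change i < idx m; omega))
  have hidx_eq (i j) (hj : j < n i) : idx (N i + j) = i := by
    refine le_antisymm (Nat.find_min' _ (by rw [hN]; omega)) (not_lt.1 fun h => ?_)
    have := hidx (N i + j)
    have := hmono (show idx (N i + j) + 1 ≤ i from h)
    omega
  let π : ℕ → V := fun m => seg (idx m) (m - N (idx m))
  have hπ (i j) (hj : j < n i) : π (N i + j) = seg i j := by simp [π, hidx_eq i j hj]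
  have hempty (i d : ℕ) (h : ∀ j, i ≤ j → j < i + d → n j = 0) : seg (i + d) 0 = seg i 0 := by
    induction d with
    | zero => rfl
    | succ d ih =>
      rw [← ih fun j h₁ h₂ => h j h₁ (by omega), ← add_assoc, ← hseg, h _ (by omega) (by omega)]
  have hπN (i) : π (N i) = seg i 0 := by
    -- Several empty segments may begin at `N i`. The index found is that of the next nonempty
    -- segment, and `hempty` identifies its start with `seg i 0`.
    have hle : i ≤ idx (N i) := not_lt.1 fun h => by
      have := hidx (N i)
      have := hmono (show idx (N i) + 1 ≤ i from h)
      omega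
    have heq : N (idx (N i)) = N i := (hidx' _).antisymm (hmono hle)
    obtain ⟨d, hd⟩ := Nat.exists_eq_add_of_le hle
    simp only [π, heq, Nat.sub_self]
    rw [hd]
    refine hempty i d fun j h₁ h₂ => ?_
    have := hmono h₁
    have := hmono (show j + 1 ≤ idx (N i) by omega)
    have := hN j
    omega
  have hdec (m) : ∃ i, ∃ j < n i, m = N i + j :=
    ⟨idx m, m - N (idx m), by have := hidx m; have := hidx' m; have := hN (idx m); omega,
      by have := hidx' m; omega⟩
  refine ⟨π, N, hπN 0, fun m => ?_, hmono, hN, hπ, hdec⟩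
  obtain ⟨i, j, hj, rfl⟩ := hdec m
  rw [hπ i j hj]
  rcases (Nat.succ_le_iff.2 hj).lt_or_eq with h | h
  · rw [add_assoc, hπ i (j + 1) h]
    exact hR i j hj
  · rw [add_assoc, show j + 1 = n i from h, ← hN, hπN, ← hseg, ← h]
    exact hR i j hj

section Soundness

variable [ConverseActions A] {M : Model.{u, v, w} P A}

/-! ### Guided paths and their weights. -/

namespace Strategy

/-- A nonempty `f`-guided match from `v` to `v'` on which `k` is the maximal priority of a position
before the last. -/
inductive Path (f : Strategy M) (v : Pos M) : ℕ → Pos M → Prop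
  | single {v' : Pos M} : f.Step v v' → Path f v v.1.priority v'
  | snoc {v' v'' : Pos M} {k : ℕ} :
      Path f v k v' → f.Step v' v'' → Path f v (max k v'.1.priority) v''

variable {f : Strategy M}

theorem Path.trans {v v' v'' : Pos M} {k l : ℕ} (h : f.Path v k v') (h' : f.Path v' l v'') :
    f.Path v (max k l) v'' := by
  induction h' with
  | single hs => exact h.snoc hs
  | snoc _ hs ih => rw [← max_assoc]; exact ih.snoc hs

theorem Path.one_le {v v' : Pos M} {k : ℕ} (h : f.Path v k v') : 1 ≤ k := by
  induction h with
  | single => exact Fm.one_le_priority _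
  | snoc _ _ ih => exact ih.trans (le_max_left _ _)

theorem Path.winsFrom (hf : f.Positional) {v v' : Pos M} {k : ℕ} (h : f.Path v k v')
    (hv : f.WinsFrom v) : f.WinsFrom v' := by
  induction h with
  | single hs => exact hv.of_step hf hs
  | snoc _ hs ih => exact ih.of_step hf hs

theorem Path.exists_seq {v v' : Pos M} {k : ℕ} (h : f.Path v k v') :
    ∃ (π : ℕ → Pos M) (n : ℕ), π 0 = v ∧ π n = v' ∧ (∀ i < n, f.Step (π i) (π (i + 1))) ∧
      (∀ i < n, (π i).1.priority ≤ k) ∧ ∃ i < n, (π i).1.priority = k := by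
  induction h with
  | @single v' hs =>
    refine ⟨fun i => if i = 0 then v else v', 1, rfl, rfl, fun i hi => ?_, fun i hi => ?_, 0, ?_⟩
    · obtain rfl : i = 0 := by omega
      exact hs
    · obtain rfl : i = 0 := by omega
      exact le_rfl
    · exact ⟨one_pos, rfl⟩
  | @snoc v' v'' k _ hs ih =>
    obtain ⟨π, n, h0, hn, hπ, hle, i₀, hi₀, heq⟩ := ih
    have hsame (i) (hi : i ≤ n) : (if i ≤ n then π i else v'') = π i := if_pos hi
    refine ⟨fun i => if i ≤ n then π i else v'', n + 1, by simp [h0], by simp, fun i hi => ?_,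
      fun i hi => ?_, ?_⟩
    · simp only [hsame i (by omega)]
      rcases (Nat.lt_succ_iff.1 hi).lt_or_eq with hi | rfl
      · rw [hsame _ hi]; exact hπ i hi
      · rw [if_neg (by omega), hn]; exact hs
    · simp only [hsame i (by omega)]
      rcases (Nat.lt_succ_iff.1 hi).lt_or_eq with hi | rfl
      · exact (hle i hi).trans (le_max_left _ _)
      · rw [hn]; exact le_max_right _ _
    · rcases le_total k v'.1.priority with h | h
      · exact ⟨n, by omega, by simp only [if_pos le_rfl, hn, max_eq_right h]⟩
      · exact ⟨i₀, by omega, by simp only [hsame i₀ hi₀.le, heq, max_eq_left h]⟩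

theorem path_of_seq {π : ℕ → Pos M} {n : ℕ} (hn : 0 < n)
    (h : ∀ i < n, f.Step (π i) (π (i + 1))) :
    f.Path (π 0) ((Finset.range n).sup fun i => (π i).1.priority) (π n) := by
  induction n, hn using Nat.le_induction with
  | base => simpa using Path.single (h 0 one_pos)
  | succ n hn ih =>
    rw [Finset.range_add_one, Finset.sup_insert, sup_comm]
    exact (ih fun i hi => h i (by omega)).snoc (h n (by omega))

theorem Positional.path_of_holdsTrace (hf : f.Positional) {s : M.State} {φ ψ : Sentence P A}
    {k : ℕ} (h : HoldsTrace M f s φ k ψ) : f.Path (φ, s) k (ψ, s) := by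
  obtain ⟨π, n, hn, h0, h1, hg, rfl⟩ := h
  rw [← h0, ← h1]
  exact path_of_seq hn ((hf.guides_iff π n).1 hg)

theorem Positional.holdsTrace_of_path (hf : f.Positional) {s : M.State} {φ ψ : Sentence P A}
    {k : ℕ} (h : f.Path (φ, s) k (ψ, s)) : HoldsTrace M f s φ k ψ := by
  obtain ⟨π, n, h0, h1, hs, hle, i, hi, heq⟩ := h.exists_seq
  refine ⟨π, n, by omega, h0, h1, (hf.guides_iff π n).2 hs, le_antisymm ?_ ?_⟩
  · exact Finset.sup_le fun i hi => hle i (Finset.mem_range.1 hi)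
  · rw [← heq]
    exact Finset.le_sup (f := fun i => (π i).1.priority) (Finset.mem_range.2 hi)

/-- A path of weight `k`, or the empty path of weight `1`. -/
def Link (f : Strategy M) (v : Pos M) (k : ℕ) (v' : Pos M) : Prop :=
  f.Path v k v' ∨ (v' = v ∧ k = 1)

theorem Link.winsFrom (hf : f.Positional) {v v' : Pos M} {k : ℕ} (h : f.Link v k v')
    (hv : f.WinsFrom v) : f.WinsFrom v' := by
  rcases h with h | ⟨rfl, -⟩
  · exact h.winsFrom hf hv
  · exact hv

/-- An empty link has weight `1` without any position attaining it, so attainment is claimed for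
larger weights only. This suffices, since a positive even weight exceeds `1`. -/
theorem Link.exists_seq {v v' : Pos M} {k : ℕ} (h : f.Link v k v') :
    ∃ (π : ℕ → Pos M) (n : ℕ), π 0 = v ∧ π n = v' ∧ (∀ i < n, f.Step (π i) (π (i + 1))) ∧
      (∀ i < n, (π i).1.priority ≤ k) ∧ 1 ≤ k ∧ (1 < k → ∃ i < n, (π i).1.priority = k) := by
  rcases h with h | ⟨rfl, rfl⟩
  · obtain ⟨π, n, h₁, h₂, h₃, h₄, h₅⟩ := h.exists_seq
    exact ⟨π, n, h₁, h₂, h₃, h₄, h.one_le, fun _ => h₅⟩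
  · exact ⟨fun _ => v', 0, rfl, rfl, by simp, by simp, le_rfl, by simp⟩

/-- A winning strategy does not guide a sequence of links whose maximal recurring weight is even. -/
theorem WinsFrom.not_even_of_link (hf : f.Positional) {v : ℕ → Pos M} {k : ℕ → ℕ} {K : ℕ}
    (hv : f.WinsFrom (v 0)) (h : ∀ i, f.Link (v i) (k i) (v (i + 1))) (hK : LimMax k K) :
    ¬ Even K := by
  intro heven
  choose seg n h₁ h₂ h₃ h₄ h₅ h₆ using fun i => (h i).exists_seq
  obtain ⟨hfreq, hle⟩ := hK
  have hK1 : 1 < K := by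
    obtain ⟨i, rfl⟩ := hfreq.exists
    have := h₅ i
    rcases this.lt_or_eq with h | h
    · exact h
    · rw [← h] at heven
      exact absurd heven (by decide)
  obtain ⟨π, N, hπ0, hπ, hmono, hN, hπseg, hdec⟩ := exists_concat f.Step n seg
    (fun i => (h₂ i).trans (h₁ (i + 1)).symm) h₃ (hfreq.mono fun i hi => by
      obtain ⟨j, hj, -⟩ := h₆ i (hi ▸ hK1)
      omega)
  obtain ⟨L, hL, hl⟩ := hv.2 π (hπ0.trans (h₁ 0)) ((hf.forall_guides_iff π).2 hπ)
  have hl' : LimMax (fun i => (π i).1.priority) K := by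
    refine ⟨frequently_atTop.2 fun m => ?_, ?_⟩
    · obtain ⟨i, j, hj, hm⟩ := hdec m
      obtain ⟨i', hi', hk⟩ := frequently_atTop.1 hfreq (i + 1)
      obtain ⟨j', hj', hp⟩ := h₆ i' (hk ▸ hK1)
      have := hmono hi'
      have := hN i
      exact ⟨N i' + j', by omega, by simp only [hπseg i' j' hj', hp, hk]⟩
    · obtain ⟨i₀, hi₀⟩ := eventually_atTop.1 hle
      refine eventually_atTop.2 ⟨N i₀, fun m hm => ?_⟩
      obtain ⟨i, j, hj, rfl⟩ := hdec m
      simp only [hπseg i j hj]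
      refine (h₄ i j hj).trans (hi₀ i (not_lt.1 fun hi => ?_))
      have := hmono (show i + 1 ≤ i₀ from hi)
      have := hN i
      omega
  obtain rfl := hl.unique hl'
  exact Nat.not_even_iff_odd.2 hL heven

end Strategy

/-- Satisfaction of items, where trace atoms are only considered if `∃` wins from their target. -/
def Item.Sat (f : Strategy M) (s : M.State) : Item P A → Prop
  | .form φ => f.WinsFrom (φ, s)
  | .trace φ k ψ => f.Path (φ, s) k (ψ, s) ∧ f.WinsFrom (ψ, s)
  | .ntrace φ k ψ => ¬ (f.Path (φ, s) k (ψ, s) ∧ f.WinsFrom (ψ, s))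

def Sequent.Sat (f : Strategy M) (s : M.State) (Γ : Sequent P A) : Prop := ∀ X ∈ Γ, X.Sat f s

theorem Sequent.sat_union {f : Strategy M} {s : M.State} {Γ Δ : Sequent P A} :
    Sequent.Sat f s (Γ ∪ Δ) ↔ Sequent.Sat f s Γ ∧ Sequent.Sat f s Δ := by
  simp only [Sequent.Sat, Set.mem_union, or_imp, forall_and]

theorem Sequent.sat_insert {f : Strategy M} {s : M.State} {X : Item P A} {Δ : Sequent P A} :
    Sequent.Sat f s (insert X Δ) ↔ X.Sat f s ∧ Sequent.Sat f s Δ := by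
  simp [Sequent.Sat]

theorem Sequent.sat_singleton {f : Strategy M} {s : M.State} {X : Item P A} :
    Sequent.Sat f s {X} ↔ X.Sat f s := by
  simp [Sequent.Sat]

/-- Winning passes along guided matches, from the member formulas to every supported formula.
Negated atoms need no support, because `Item.Sat` only weakens them. -/
theorem Sequent.sat_of_holds {f : Strategy M} (hf : f.Positional) {s : M.State} {Γ : Sequent P A}
    (hΓ : ∀ φ k ψ, Item.trace φ k ψ ∈ Γ → Γ.Supports ψ)
    (h : ∀ X ∈ Γ, Item.Holds M f s X) : Γ.Sat f s := by
  have hsupp {ψ} (hψ : Γ.Supports ψ) : f.WinsFrom (ψ, s) := by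
    induction hψ with
    | mem hφ => exact h _ hφ
    | step _ ht ih => exact (hf.path_of_holdsTrace (h _ ht)).winsFrom hf ih
  rintro (φ | ⟨φ, k, ψ⟩ | ⟨φ, k, ψ⟩) hX
  · exact h _ hX
  · exact ⟨hf.path_of_holdsTrace (h _ hX), hsupp (hΓ _ _ _ hX)⟩
  · exact fun h' => h _ hX (hf.holdsTrace_of_path h'.1)

/-! ### Local soundness of the rules. -/

section Rules

variable {f : Strategy M} {s : M.State}

/-- A match at `s` that ends in a modal formula becomes one at `t` by prefixing the backward box
move and appending the forward move. Negated atoms use the same transport in reverse. The added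
positions have priority `1`, so the weight is unchanged. -/
theorem sat_diaPremise (hf : f.Positional) (ho : f.Optimal) {t : M.State} {a : A}
    {φ : Sentence P A} {Θ : Set (Sentence P A)} {Γ : Sequent P A}
    (h : (diaConclusion a φ Θ Γ).Sat f s) (hst : M.R a s t) (hs : f.Step (φ.dia a, s) (φ, t)) :
    (diaPremise a φ Θ Γ).Sat f t := by
  simp only [diaConclusion, Sequent.sat_union, Sequent.sat_singleton] at h
  obtain ⟨⟨hφ, hΘ⟩, hΓ⟩ := h
  have hts : M.R (ConverseActions.conv a) t s := (M.conv_iff a t s).2 hst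
  have hbox (β : Sentence P A) : f.Step (β.box a, s) (β, t) := ⟨.box β hst, fun h => h.elim⟩
  have hback (χ : Sentence P A) : f.Step (χ.box (ConverseActions.conv a), t) (χ, s) :=
    ⟨.box χ hts, fun h => h.elim⟩
  have htrace {χ γ β : Sentence P A} {k : ℕ} (hγ : γ.priority = 1) (hs : f.Step (γ, s) (β, t))
      (h : Item.Sat f s (.trace χ k γ)) :
      Item.Sat f t (.trace (χ.box (ConverseActions.conv a)) k β) := by
    refine ⟨?_, h.2.of_step hf hs⟩
    have := ((Strategy.Path.single (hback χ)).trans h.1).snoc hs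
    have h1 := h.1.one_le
    change f.Path _ (max (max 1 k) γ.priority) _ at this
    rwa [show max (max 1 k) γ.priority = k by omega] at this
  have hntrace {χ γ β : Sentence P A} {k : ℕ} (hγ : γ.priority = 1) (hs : f.Step (γ, s) (β, t))
      (h : Item.Sat f s (.ntrace γ k χ)) :
      Item.Sat f t (.ntrace β k (χ.box (ConverseActions.conv a))) := by
    rintro ⟨hp, hw⟩
    refine h ⟨?_, hw.of_step hf (hback χ)⟩
    have := ((Strategy.Path.single hs).trans hp).snoc (hback χ)
    have h1 := hp.one_le
    change f.Path _ (max (max γ.priority k) 1) _ at this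
    rwa [show max (max γ.priority k) 1 = k by omega] at this
  simp only [diaPremise, Sequent.sat_union, Sequent.sat_singleton]
  refine ⟨⟨⟨hφ.of_step hf hs, ?_⟩, ?_⟩, ?_⟩
  · rintro _ ⟨σ, hσ, rfl⟩
    exact Strategy.WinsFrom.of_step hf (hΘ _ ⟨σ, hσ, rfl⟩) (hbox σ)
  · rintro _ ⟨χ, hχ, -, rfl⟩
    -- The strategy `f` may choose another successor than `s` here. Some strategy wins by stepping
    -- back to `s`, and optimality makes `f` win as well.
    exact ho _ (hf.exists_winsFrom_of_move trivial (.dia χ hts) (hΓ _ hχ))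
  · rintro _ (⟨h, -⟩ | ⟨h, -⟩ | ⟨h, -⟩ | ⟨h, -⟩)
    · exact htrace rfl hs (hΓ _ h)
    · exact htrace rfl (hbox _) (hΓ _ h)
    · exact hntrace rfl hs (hΓ _ h)
    · exact hntrace rfl (hbox _) (hΓ _ h)

theorem link_of_sideTrace {Γ : Sequent P A} (h : Γ.Sat f s) {φ ψ : Sentence P A} {k : ℕ}
    (hs : RuleInst.SideTrace Γ φ ψ k) : f.WinsFrom (φ, s) ∧ f.Link (φ, s) k (ψ, s) := by
  obtain ⟨h₁, rfl, rfl⟩ := hs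
  exact ⟨h _ h₁, Or.inr ⟨rfl, rfl⟩⟩

/-- If the conclusion of a rule instance is satisfied, then so is some premise, and the upward
traces to it are matches. -/
theorem exists_sat_premise (hf : f.Positional) (ho : f.Optimal) (r : RuleInst P A)
    (h : r.conclusion.Sat f s) :
    ∃ (i : ℕ) (hi : i < r.premises.length) (t : M.State), (r.premises[i]).Sat f t ∧
      ∀ φ ψ k, r.UpTrace i φ ψ k → f.WinsFrom (φ, s) ∧ f.Link (φ, s) k (ψ, t) := by
  have hside (Γ : Sequent P A) (hΓ : Γ.Sat f s) (φ ψ : Sentence P A) (k : ℕ) :=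
    @link_of_sideTrace _ _ _ _ f s Γ hΓ φ ψ k
  cases r with
  | ax1 φ Γ =>
    simp only [RuleInst.conclusion, Sequent.sat_union, Sequent.sat_insert,
      Sequent.sat_singleton] at h
    exact absurd h.1.2 (Strategy.WinsFrom.not_negPos hf h.1.1)
  | ax2 Γ =>
    have hw : f.WinsFrom (.bot, s) := h _ (Or.inl rfl)
    obtain ⟨v', hv'⟩ := hw.exists_move trivial
    cases hv'
  | ax3 φ k ψ Γ =>
    simp only [RuleInst.conclusion, Sequent.sat_union, Sequent.sat_insert,
      Sequent.sat_singleton] at h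
    exact absurd h.1.1 h.1.2
  | ax4 φ k Γ =>
    obtain ⟨hp, hw⟩ : Item.Sat f s (.trace φ (2 * k) φ) := h _ (Or.inl rfl)
    -- The loop is repeated forever; winning at its target, part of `Item.Sat`, makes this a
    -- contradiction.
    exact absurd (even_two_mul k) (Strategy.WinsFrom.not_even_of_link hf (v := fun _ => (φ, s))
      hw (fun _ => Or.inl hp) ⟨Frequently.of_forall fun _ => rfl, by simp⟩)
  | and φ ψ Γ =>
    simp only [RuleInst.conclusion, Sequent.sat_union, Sequent.sat_singleton] at h
    obtain ⟨h, hΓ⟩ := h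
    change f.WinsFrom _ at h
    have h₁ : f.Step (φ.and ψ, s) (φ, s) := ⟨.and_left _ _ _, fun h => h.elim⟩
    have h₂ : f.Step (φ.and ψ, s) (ψ, s) := ⟨.and_right _ _ _, fun h => h.elim⟩
    refine ⟨0, by simp [RuleInst.premises], s, ?_, ?_⟩
    · simp only [RuleInst.premises, List.getElem_cons_zero, Sequent.sat_union, Sequent.sat_insert,
        Sequent.sat_singleton]
      exact ⟨⟨h.of_step hf h₁, h.of_step hf h₂, ⟨.single h₁, h.of_step hf h₁⟩,
        .single h₂, h.of_step hf h₂⟩, hΓ⟩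
    · rintro χ θ k (hs | ⟨rfl, rfl | rfl, rfl⟩)
      · exact hside Γ hΓ _ _ _ hs
      · exact ⟨h, Or.inl (.single h₁)⟩
      · exact ⟨h, Or.inl (.single h₂)⟩
  | or φ ψ Γ =>
    simp only [RuleInst.conclusion, Sequent.sat_union, Sequent.sat_singleton] at h
    obtain ⟨h, hΓ⟩ := h
    change f.WinsFrom _ at h
    have hs := f.step_move (v := (φ.or ψ, s)) trivial (h.exists_move trivial)
    generalize f.move [] _ = v' at hs
    rcases hm : hs.1 with _ | _
    · refine ⟨0, by simp [RuleInst.premises], s, ?_, ?_⟩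
      · simp only [RuleInst.premises, List.getElem_cons_zero, Sequent.sat_union,
          Sequent.sat_insert, Sequent.sat_singleton]
        exact ⟨⟨h.of_step hf hs, .single hs, h.of_step hf hs⟩, hΓ⟩
      · rintro χ θ k (hs' | ⟨rfl, ⟨-, rfl⟩ | ⟨h', -⟩, rfl⟩)
        · exact hside Γ hΓ _ _ _ hs'
        · exact ⟨h, Or.inl (.single hs)⟩
        · exact absurd h' (by decide)
    · refine ⟨1, by simp [RuleInst.premises], s, ?_, ?_⟩
      · simp only [RuleInst.premises, List.getElem_cons_succ, List.getElem_cons_zero,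
          Sequent.sat_union, Sequent.sat_insert, Sequent.sat_singleton]
        exact ⟨⟨h.of_step hf hs, .single hs, h.of_step hf hs⟩, hΓ⟩
      · rintro χ θ k (hs' | ⟨rfl, ⟨h', -⟩ | ⟨-, rfl⟩, rfl⟩)
        · exact hside Γ hΓ _ _ _ hs'
        · exact absurd h' (by decide)
        · exact ⟨h, Or.inl (.single hs)⟩
  | mu φ Γ =>
    simp only [RuleInst.conclusion, Sequent.sat_union, Sequent.sat_singleton] at h
    obtain ⟨h, hΓ⟩ := h
    change f.WinsFrom _ at h
    have h₁ : f.Step (φ.mu, s) (φ.unfoldMu, s) := ⟨.mu _ _, fun h => h.elim⟩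
    refine ⟨0, by simp [RuleInst.premises], s, ?_, ?_⟩
    · simp only [RuleInst.premises, List.getElem_cons_zero, Sequent.sat_union, Sequent.sat_insert,
        Sequent.sat_singleton]
      exact ⟨⟨h.of_step hf h₁, .single h₁, h.of_step hf h₁⟩, hΓ⟩
    · rintro χ θ k (hs | ⟨rfl, rfl, rfl⟩)
      · exact hside Γ hΓ _ _ _ hs
      · exact ⟨h, Or.inl (.single h₁)⟩
  | nu φ Γ =>
    simp only [RuleInst.conclusion, Sequent.sat_union, Sequent.sat_singleton] at h
    obtain ⟨h, hΓ⟩ := h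
    change f.WinsFrom _ at h
    have h₁ : f.Step (φ.nu, s) (φ.unfoldNu, s) := ⟨.nu _ _, fun h => h.elim⟩
    refine ⟨0, by simp [RuleInst.premises], s, ?_, ?_⟩
    · simp only [RuleInst.premises, List.getElem_cons_zero, Sequent.sat_union, Sequent.sat_insert,
        Sequent.sat_singleton]
      exact ⟨⟨h.of_step hf h₁, .single h₁, h.of_step hf h₁⟩, hΓ⟩
    · rintro χ θ k (hs | ⟨rfl, rfl, rfl⟩)
      · exact hside Γ hΓ _ _ _ hs
      · exact ⟨h, Or.inl (.single h₁)⟩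
  | dia a φ Θ Γ =>
    have hφ : f.WinsFrom (φ.dia a, s) := h _ (Or.inl (Or.inl rfl))
    have hs := f.step_move (v := (φ.dia a, s)) trivial (hφ.exists_move trivial)
    obtain ⟨t, ht, hst⟩ : ∃ t, f.move [] (φ.dia a, s) = (φ, t) ∧ M.R a s t := by
      obtain ⟨hm, -⟩ := hs
      generalize f.move [] _ = v' at hm
      cases hm with
      | dia _ h => exact ⟨_, rfl, h⟩
    rw [ht] at hs
    refine ⟨0, by simp [RuleInst.premises], t, sat_diaPremise hf ho h hst hs, ?_⟩
    rintro χ θ k ⟨⟨rfl, rfl⟩ | ⟨hθ, rfl⟩, rfl⟩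
    · exact ⟨hφ, Or.inl (.single hs)⟩
    · exact ⟨h _ (Or.inl (Or.inr ⟨θ, hθ, rfl⟩)),
        Or.inl (.single ⟨.box θ hst, fun h => h.elim⟩)⟩
  | trans φ k ψ l χ Γ =>
    simp only [RuleInst.conclusion, Sequent.sat_union, Sequent.sat_insert,
      Sequent.sat_singleton] at h
    obtain ⟨⟨h₁, h₂⟩, hΓ⟩ := h
    refine ⟨0, by simp [RuleInst.premises], s, ?_, hside Γ hΓ⟩
    simp only [RuleInst.premises, List.getElem_cons_zero, Sequent.sat_union, Sequent.sat_insert,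
      Sequent.sat_singleton]
    exact ⟨⟨h₁, h₂, h₁.1.trans h₂.1, h₂.2⟩, hΓ⟩
  | cut φ Γ hφ =>
    rcases exists_winsFrom_or_neg (M := M) (φ, s) with h' | h'
    · exact ⟨0, by simp [RuleInst.premises], s,
        Sequent.sat_union.2 ⟨Sequent.sat_singleton.2 (ho _ h'), h⟩, hside Γ h⟩
    · exact ⟨1, by simp [RuleInst.premises], s,
        Sequent.sat_union.2 ⟨Sequent.sat_singleton.2 (ho _ h'), h⟩, hside Γ h⟩
  | tcut φ k ψ Γ hφ hψ =>
    by_cases h' : Item.Sat f s (.trace φ k ψ)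
    · exact ⟨0, by simp [RuleInst.premises], s,
        Sequent.sat_union.2 ⟨Sequent.sat_singleton.2 h', h⟩, hside Γ h⟩
    · exact ⟨1, by simp [RuleInst.premises], s,
        Sequent.sat_union.2 ⟨Sequent.sat_singleton.2 h', h⟩, hside Γ h⟩
  | weak X Γ =>
    have hΓ := (Sequent.sat_union.1 h).2
    exact ⟨0, by simp [RuleInst.premises], s, hΓ, hside Γ hΓ⟩

end Rules

/-- A well-formed derivation of a satisfied sequent has a branch along which all sequents are
satisfied and all upward traces are matches. -/
theorem Derivation.exists_sat_branch {D : Derivation P A} (hD : D.WellFormed) {f : Strategy M}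
    (hf : f.Positional) (ho : f.Optimal) {s : M.State} (h : (D.sequent []).Sat f s) :
    ∃ (b : ℕ → ℕ) (t : ℕ → M.State), D.IsBranch b ∧
      (∀ n, (D.sequent (nodeAt b n)).Sat f (t n)) ∧
      ∀ n φ ψ k, (D.rule (nodeAt b n)).UpTrace (b n) φ ψ k →
        f.WinsFrom (φ, t n) ∧ f.Link (φ, t n) k (ψ, t (n + 1)) := by
  have hnext (x : {x : List ℕ × M.State // D.Node x.1 ∧ (D.sequent x.1).Sat f x.2}) :
      ∃ (i : ℕ) (y : {x : List ℕ × M.State // D.Node x.1 ∧ (D.sequent x.1).Sat f x.2}),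
        y.1.1 = x.1.1 ++ [i] ∧ ∀ φ ψ k, (D.rule x.1.1).UpTrace i φ ψ k →
          f.WinsFrom (φ, x.1.2) ∧ f.Link (φ, x.1.2) k (ψ, y.1.2) := by
    obtain ⟨⟨x, s⟩, hx, hs⟩ := x
    obtain ⟨i, hi, t, ht, hup⟩ := exists_sat_premise hf ho (D.rule x) hs
    exact ⟨i, ⟨(x ++ [i], t), hx.child hi, by rwa [← hD.2 x hx i hi] at ht⟩, rfl, hup⟩
  choose i y hy hup using hnext
  let x : ℕ → {x : List ℕ × M.State // D.Node x.1 ∧ (D.sequent x.1).Sat f x.2} :=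
    fun n => y^[n] ⟨([], s), .root, h⟩
  have hx (n) : x (n + 1) = y (x n) := Function.iterate_succ_apply' _ _ _
  have hnode (n) : nodeAt (fun n => i (x n)) n = (x n).1.1 := by
    induction n with
    | zero => rfl
    | succ n ih =>
      rw [hx, hy, ← ih]
      simp [nodeAt, List.range_succ]
  refine ⟨fun n => i (x n), fun n => (x n).1.2, fun n => ?_, fun n => ?_, fun n => ?_⟩
  · rw [hnode]; exact (x n).2.1
  · rw [hnode]; exact (x n).2.2
  · rw [hnode]; simp only [hx]; exact hup (x n)

/-- The conclusion of an `NW²`-proof is not satisfied. -/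
theorem Derivation.IsProof.not_sat {D : Derivation P A} (hD : D.IsProof) {f : Strategy M}
    (hf : f.Positional) (ho : f.Optimal) (s : M.State) : ¬ (D.sequent []).Sat f s := by
  intro h
  obtain ⟨b, t, hb, hsat, hup⟩ := Derivation.exists_sat_branch hD.1 hf ho h
  obtain ⟨d, φ, k, htrail, K, hK, hlim⟩ := hD.2 b hb
  have hlink (i) : f.Link (φ i, t (d i)) (k i) (φ (i + 1), t (d (i + 1))) ∧
      f.WinsFrom (φ (i + 1), t (d (i + 1))) := by
    rcases htrail i with ⟨hd, hm⟩ | ⟨hd, hm⟩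
    · obtain ⟨hp, hw⟩ : Item.Sat f _ (.trace _ _ _) := hsat _ _ hm
      rw [hd]
      exact ⟨Or.inl hp, hw⟩
    · obtain ⟨hw, hl⟩ := hup _ _ _ _ hm
      rw [hd]
      exact ⟨hl, hl.winsFrom hf hw⟩
  -- The first triple is dropped: if it is a detour, only its target is known to be winning.
  exact Strategy.WinsFrom.not_even_of_link hf (v := fun i => (φ (i + 1), t (d (i + 1))))
    (hlink 0).2 (fun i => (hlink (i + 1)).1) (hlim.shift 1) hK

end Soundness

end TwoWayMu

theorem mainTheorem1 {P : Type u} {A : Type v} [TwoWayMu.ConverseActions A]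
    (Γ : TwoWayMu.Sequent P A)
    (hΓ : ∀ (φ : TwoWayMu.Sentence P A) (k : ℕ) (ψ : TwoWayMu.Sentence P A),
      TwoWayMu.Item.trace φ k ψ ∈ Γ → Γ.Supports ψ)
    (h : TwoWayMu.NW2Derivable Γ) :
    ¬ TwoWayMu.Sequent.Satisfiable.{u, v, w} Γ := by
  obtain ⟨D, hD, rfl⟩ := h
  rintro ⟨M, s, f, hf, ho, hs⟩
  exact hD.not_sat hf ho s (TwoWayMu.Sequent.sat_of_holds hf hΓ hs)
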